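/- Let $d,m\ge 1$ be integers and let $|\cdot|$ be the Euclidean norm. Let $\mathcal P_1(\mathbb R^d)$ be the set of probability measures on $\mathbb R^d$ with finite first moment, and let $\mathcal W_1(\mu,\nu)=\inf E|X-Y|$, the infimum being over all couplings $(X,Y)$ of $\mu$ and $\nu$. Let $A$ be a $d\times d$ matrix, $\delta\ge 0$, $\theta$ a probability measure on $\mathbb R^m$, and $f:\mathbb R^d\times\mathcal P(\mathbb R^d)\times\mathbb R^m\to\mathbb R^d$ a measurable function. For every $N\ge 1$ let $(X_0^{1},\dots,X_0^{N})=(X_0^{1,N},\dots,X_0^{N,N})$ be exchangeable random vectors in $\mathbb R^d$ with common law $\mu_0$ (not depending on $N$), let $(\epsilon_n^i)_{n\ge 1,\,1\le i\le N}$ be i.i.d. with law $\theta$ and independent of $(X_0^{1},\dots,X_0^N)$, and let $$X_{n+1}^{i}=AX_n^{i}+\delta f(X_n^{i},\mu_n^N,\epsilon_{n+1}^i),\qquad \mu_n^N=\frac1N\sum_{i=1}^N\delta_{X_n^{i}},\qquad n\ge 0 .$$ Let $\mu_{n+1}=\Psi(\mu_n)$ for $n\ge0$, where $\Psi(\mu)$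 is the law of $AX+\delta f(X,\mu,\epsilon)$ when $(X,\epsilon)$ has law $\mu\otimes\theta$. Put $$D(z)=\sup\left\{\frac{|f(x_1,\nu_1,z)-f(x_2,\nu_2,z)|}{|x_1-x_2|+\mathcal W_1(\nu_1,\nu_2)} : x_1\ne x_2\in\mathbb R^d,\ \nu_1\neq \nu_2\in\mathcal P_1(\mathbb R^d)\right\},\qquad D_1(z)=|f(0,\delta_0,z)| .$$ Assume that - $\|A\|\le e^{-\omega}$ for some $\omega>0$, where $\|A\|=\sup_{x\ne0}|Ax|/|x|$; - $D(z)\le M$ for $\theta$-a.e. $z$, for some $M\in(1,\infty)$; - $\int e^{\alpha|x|}\mu_0(dx)<\infty$ and $\int e^{\alpha D_1(z)}\theta(dz)<\infty$ for some $\alpha>0$. Let $\sigma=\int D\,d\theta$ and $a_0=\frac{1-e^{-\omega}}{2\sigma}$ ($a_0=\infty$ if $\sigma=0$). Fix $\gamma_0\in(0,a_0)$ and suppose that $$\delta\in\Big[0,\min\Big\{a_0-\gamma_0,\ \frac{1-e^{-\omega}}{2M}\Big\}\Big).$$ Let $\vartheta=\frac{1-2\sigma\gamma_0}{e^{-\omega}+2\delta\sigma}$.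 Then $\vartheta>1$, and there exist $N_0\in\{1,2,\dots\}$ and $C_1\in(0,\infty)$ such that for all $\varepsilon>0$ the following holds. Write $\log^+ t=\max\{0,\log t\}$. If $d>1$, then $$P\big[\mathcal W_1(\mu_n^N,\mu_n)>\varepsilon\big]\le P\big[\mathcal W_1(\mu_0^N,\mu_0)>2\sigma\gamma_0\vartheta^n\varepsilon\big]+\exp\big(-C_1\,\varepsilon\,N^{1/(d+2)}\big)$$ for all $n\ge 0$ and all $N\ge N_0\max\big\{\big(\tfrac1\varepsilon\log^+\tfrac1\varepsilon\big)^{d+2},\ \varepsilon^{(d+2)/(d-1)}\big\}$. If $d=1$, then $$P\big[\mathcal W_1(\mu_n^N,\mu_n)>\varepsilon\big]\le P\big[\mathcal W_1(\mu_0^N,\mu_0)>2\sigma\gamma_0\vartheta^n\varepsilon\big]+\exp\big(-C_1(\varepsilon\wedge1)N^{1/(d+2)}\big)$$ for all $n\ge 0$ and all $N\ge N_0\max\big\{\big(\tfrac1\varepsilon\log^+\tfrac1\varepsilon\big)^{d+2},\ 1\big\}$. -/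

import Mathlib

open MeasureTheory ProbabilityTheory
open scoped ENNReal

noncomputable section

namespace WeaklyInteracting

/-- `ℝᵈ` with the Euclidean norm. -/
abbrev E (d : ℕ) : Type := EuclideanSpace ℝ (Fin d)

/-- Membership in `𝒫₁(ℝᵈ)`: finite first moment. -/
def FiniteFirstMoment {d : ℕ} (μ : ProbabilityMeasure (E d)) : Prop :=
  ∫⁻ x, ‖x‖ₑ ∂(μ : Measure (E d)) < ∞

/-- The Wasserstein-1 distance: the infimum of `E|X - Y|` over all couplings, i.e. over all joint
laws `π` of pairs `(X, Y)` with marginals `μ` and `ν`. It is finite on `𝒫₁(ℝᵈ)`. -/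
def W1 {d : ℕ} (μ ν : ProbabilityMeasure (E d)) : ℝ≥0∞ :=
  ⨅ (π : Measure (E d × E d)) (_ : π.map Prod.fst = μ ∧ π.map Prod.snd = ν),
    ∫⁻ p, ‖p.1 - p.2‖ₑ ∂π

/-- The Dirac mass at `x`. -/
def diracPM {d : ℕ} (x : E d) : ProbabilityMeasure (E d) :=
  ⟨Measure.dirac x, inferInstance⟩

/-- The empirical measure `N⁻¹ ∑ᵢ δ_{xᵢ}` of a configuration of `N ≥ 1` points. -/
def empirical {d : ℕ} {N : ℕ+} (x : Fin N → E d) : ProbabilityMeasure (E d) :=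
  ⟨((N : ℕ) : ℝ≥0∞)⁻¹ • ∑ i, Measure.dirac (x i), ⟨by
    have h : ((N : ℕ) : ℝ≥0∞) ≠ 0 := by exact_mod_cast N.ne_zero
    simpa using ENNReal.inv_mul_cancel h (ENNReal.natCast_ne_top _)⟩⟩

/-- The data of the dynamics `x ↦ A x + δ f(x, ρ, z)`: the linear map `A` on `ℝᵈ` (a `d × d`
matrix; `‖A‖` is the operator norm for the Euclidean norm), the parameter `δ`, the measurable
nonlinearity `f : ℝᵈ × 𝒫(ℝᵈ) × ℝᵐ → ℝᵈ`, and the law `θ` of the noise. -/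
structure Model (d m : ℕ) where
  A : E d →L[ℝ] E d
  δ : ℝ
  f : E d → ProbabilityMeasure (E d) → E m → E d
  measurable_f :
    Measurable (fun p : E d × ProbabilityMeasure (E d) × E m => f p.1 p.2.1 p.2.2)
  θ : ProbabilityMeasure (E m)

namespace Model

variable {d m : ℕ} (S : Model d m)

/-- One step of the dynamics. -/
def step (x : E d) (ρ : ProbabilityMeasure (E d)) (z : E m) : E d :=
  S.A x + S.δ • S.f x ρ z

theorem measurable_step (ρ : ProbabilityMeasure (E d)) :
    Measurable (fun p : E d × E m => S.step p.1 ρ p.2) := by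
  have h : Measurable (fun p : E d × E m => S.f p.1 ρ p.2) :=
    S.measurable_f.comp (measurable_fst.prodMk (measurable_const.prodMk measurable_snd))
  exact (S.A.measurable.comp measurable_fst).add (h.const_smul S.δ)

/-- The (random) Lipschitz constant `D(z)` of `f(·, ·, z)` on `ℝᵈ × 𝒫₁(ℝᵈ)`. -/
def D (z : E m) : ℝ≥0∞ :=
  ⨆ (x₁ : E d) (x₂ : E d) (μ₁ : ProbabilityMeasure (E d)) (μ₂ : ProbabilityMeasure (E d))
    (_ : x₁ ≠ x₂ ∧ μ₁ ≠ μ₂ ∧ FiniteFirstMoment μ₁ ∧ FiniteFirstMoment μ₂),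
    ‖S.f x₁ μ₁ z - S.f x₂ μ₂ z‖ₑ / (‖x₁ - x₂‖ₑ + W1 μ₁ μ₂)

/-- `D₁(z) = |f(0, δ₀, z)|`. -/
def D₁ (z : E m) : ℝ := ‖S.f 0 (diracPM 0) z‖

/-- `σ = ∫ D dθ` (finite as soon as `D` is essentially bounded). -/
def σ : ℝ := (∫⁻ z, S.D z ∂(S.θ : Measure (E m))).toReal

/-- `a₀ = (1 - e^{-ω}) / (2σ)`, which is `∞` if `σ = 0`. -/
def a₀ (ω : ℝ) : ℝ≥0∞ :=
  ENNReal.ofReal (1 - Real.exp (-ω)) / ENNReal.ofReal (2 * S.σ)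

/-- `ϑ = (1 - 2σγ₀) / (e^{-ω} + 2δσ)`. -/
def ϑ (ω γ₀ : ℝ) : ℝ := (1 - 2 * S.σ * γ₀) / (Real.exp (-ω) + 2 * S.δ * S.σ)

/-- `Ψ(μ) = μ P^μ`, the law of `A X + δ f(X, μ, ε)` when `(X, ε)` has law `μ ⊗ θ`. -/
def Psi (μ : ProbabilityMeasure (E d)) : ProbabilityMeasure (E d) :=
  ⟨((μ : Measure (E d)).prod (S.θ : Measure (E m))).map (fun p => S.step p.1 μ p.2),
    Measure.isProbabilityMeasure_map (S.measurable_step μ).aemeasurable⟩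

/-- The law `μₙ = Ψⁿ(μ₀)` of the nonlinear Markov chain at time `n`. -/
def law (μ₀ : ProbabilityMeasure (E d)) (n : ℕ) : ProbabilityMeasure (E d) :=
  S.Psi^[n] μ₀

/-- The configuration `(X_n^1, …, X_n^N)` at time `n` of the interacting particle system with
initial configuration `x₀`; the noise entering the step from time `n` to time `n + 1` of particle
`i` is `ε n i` (that is, `ε n i` stands for `ε_{n+1}^i`). -/
def particles {N : ℕ+} (x₀ : Fin N → E d) (ε : ℕ → Fin N → E m) : ℕ → Fin N → E d
  | 0 => x₀
  | n + 1 => fun i =>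
      S.step (particles x₀ ε n i) (empirical (particles x₀ ε n)) (ε n i)

end Model

/-- The probabilistic input of the `N`-particle system: exchangeable initial positions with common
law `μ₀`, and an i.i.d. array of noises with law `θ` that is independent of them. -/
structure IsInput {d m : ℕ} {N : ℕ+} {Ω : Type*} [MeasurableSpace Ω] (P : Measure Ω)
    (μ₀ : ProbabilityMeasure (E d)) (θ : ProbabilityMeasure (E m))
    (X₀ : Ω → Fin N → E d) (ε : Ω → ℕ → Fin N → E m) : Prop where
  measurable_init : Measurable X₀
  measurable_noise : Measurable ε
  exchangeable : ∀ π : Equiv.Perm (Fin N), P.map (fun ω i => X₀ ω (π i)) = P.map X₀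
  law_init : ∀ i, P.map (fun ω => X₀ ω i) = μ₀
  law_noise : ∀ n i, P.map (fun ω => ε ω n i) = θ
  indep_noise : iIndepFun (fun (p : ℕ × Fin N) (ω : Ω) => ε ω p.1 p.2) P
  indep_init_noise : IndepFun X₀ ε P

end WeaklyInteracting

end

noncomputable section

namespace WeaklyInteracting

/-! ### The Wasserstein distance -/

section Wasserstein

variable {d : ℕ}

/-! Write `k = e^{-ω} + 2δσ` and `γ = 2σγ₀`. Driving two copies of the dynamics by the same noise
shows that `Ψ` contracts `W1` by the factor `k` (`W1_Psi_le`). Comparing `μ_{n+1}^N` with `Ψ(μ_n^N)`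
at each step and iterating gives `W1(μ_n^N, μ_n) ≤ k^n W1(μ_0^N, μ_0) + ∑_{j<n} k^j F_{n-1-j}`,
where `F_i = W1(μ_{i+1}^N, Ψ(μ_i^N))` (`W1_particles_le`). Since `ϑ = (1-γ)/k`, an initial error of
at most `γ ϑ^n ε` uses up at most `γε`. The remaining `(1-γ)ε` is shared so that the fluctuation at
lag `j` may be as large as a constant times `k^{-j/2} ε` (`exists_fluctuation_gt`). These thresholds
grow geometrically, hence a union bound over `j` costs a constant independent of `n`.

A single fluctuation is controlled conditionally on the current configuration: the new particles are
then independent and their empirical measure has mean `Ψ(μ_i^N)`. Both measures are rounded to a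
lattice of mesh of order `ε` in a ball of radius `R`. Hoeffding's inequality, applied to every union
of cells, compares the rounded measures with error `t` of order `ε/R`. There are at most
exponentially many, in `(R/ε)^d`, unions of cells, against a Hoeffding exponent of order `N ε²/R²`.
With `u = N^{1/(d+2)}`, the choice `R` of order `εu` makes both of order `u^d`; this balance
produces the exponent `1/(d+2)` (`two_pow_card_quantizeRange_mul_exp_le`).

The mass outside the ball is handled by exponential moments. Convexity of `exp` yields an affine
recursion under `Ψ` with factor `e^{-ω} + 2δM < 1` (`expMoment_Psi_le`), so the expected exponential
moment of `μ_n^N` is bounded uniformly in `n` and `N`, and Markov's inequality gives an error of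
order `e^{-λR/2}` (`measure_fluctuation_gt_le`). The lower bounds on `N` say exactly what is needed
for the scale `H = εu` (or `(ε ∧ 1)u` if `d = 1`) to be compatible with all these choices. -/

theorem W1_le_of_coupling {μ ν : ProbabilityMeasure (E d)} (π : Measure (E d × E d))
    (h₁ : π.map Prod.fst = μ) (h₂ : π.map Prod.snd = ν) :
    W1 μ ν ≤ ∫⁻ p, ‖p.1 - p.2‖ₑ ∂π :=
  iInf₂_le π ⟨h₁, h₂⟩

theorem isProbabilityMeasure_of_map_eq {α β : Type*} [MeasurableSpace α] [MeasurableSpace β]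
    {π : Measure α} {g : α → β} (hg : Measurable g) {μ : ProbabilityMeasure β}
    (h : π.map g = μ) : IsProbabilityMeasure π := by
  constructor
  have : (π.map g) Set.univ = 1 := by rw [h]; exact measure_univ
  rwa [Measure.map_apply hg MeasurableSet.univ, Set.preimage_univ] at this

/-- Gluing: a coupling of `μ, ν` and a coupling of `ν, ρ` compose. -/
theorem W1_triangle (μ ν ρ : ProbabilityMeasure (E d)) : W1 μ ρ ≤ W1 μ ν + W1 ν ρ := by
  refine ENNReal.le_iInf₂_add_iInf₂ ?_
  rintro π₁ ⟨h₁, h₁'⟩ π₂ ⟨h₂, h₂'⟩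
  have : IsProbabilityMeasure π₁ := isProbabilityMeasure_of_map_eq measurable_fst h₁
  have : IsProbabilityMeasure π₂ := isProbabilityMeasure_of_map_eq measurable_fst h₂
  -- `Q` is the law of `(X, Y, Z)` with `(X, Y)` of law `π₁` and `Z` drawn from the conditional law
  -- of `π₂` given `Y`. Its `(X, Z)` marginal couples `μ` and `ρ`.
  set κ : Kernel (E d) (E d) := π₂.condKernel with hκ
  set Q : Measure ((E d × E d) × E d) := π₁ ⊗ₘ (κ.comap Prod.snd measurable_snd) with hQ
  have hQfst : Q.map Prod.fst = π₁ := Measure.fst_compProd _ _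
  have hQsnd : Q.map (fun p => (p.1.2, p.2)) = π₂ := by
    have h : π₂.fst ⊗ₘ κ = π₂ := π₂.disintegrate κ
    rw [← h]
    ext s hs
    have hm : Measurable (fun p : (E d × E d) × E d => (p.1.2, p.2)) := by fun_prop
    rw [Measure.map_apply hm hs, hQ, Measure.compProd_apply (hm hs), Measure.compProd_apply hs,
      Measure.fst, h₂, ← h₁', lintegral_map (Kernel.measurable_kernel_prodMk_left hs)
        measurable_snd]
    rfl
  have hm13 : Measurable (fun p : (E d × E d) × E d => (p.1.1, p.2)) := by fun_prop
  have hm23 : Measurable (fun p : (E d × E d) × E d => (p.1.2, p.2)) := by fun_prop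
  have key := W1_le_of_coupling (μ := μ) (ν := ρ) (Q.map (fun p => (p.1.1, p.2)))
    (by
      rw [Measure.map_map measurable_fst hm13, ← h₁, ← hQfst,
        Measure.map_map measurable_fst measurable_fst]
      rfl)
    (by
      rw [Measure.map_map measurable_snd hm13, ← h₂', ← hQsnd,
        Measure.map_map measurable_snd hm23]
      rfl)
  refine key.trans ?_
  have hc : Measurable (fun p : E d × E d => ‖p.1 - p.2‖ₑ) := by fun_prop
  rw [lintegral_map hc hm13]
  conv_rhs => rw [← hQfst, ← hQsnd, lintegral_map hc measurable_fst, lintegral_map hc hm23]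
  rw [← lintegral_add_left (by fun_prop)]
  refine lintegral_mono fun p => ?_
  have : p.1.1 - p.2 = (p.1.1 - p.1.2) + (p.1.2 - p.2) := by abel
  simp only [this]
  exact enorm_add_le _ _

theorem W1_le_W1_swap (μ ν : ProbabilityMeasure (E d)) : W1 μ ν ≤ W1 ν μ := by
  refine le_iInf₂ ?_
  rintro π ⟨h₁, h₂⟩
  refine (W1_le_of_coupling (π.map Prod.swap) ?_ ?_).trans ?_
  · rw [Measure.map_map measurable_fst measurable_swap, ← h₂]; rfl
  · rw [Measure.map_map measurable_snd measurable_swap, ← h₁]; rfl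
  · rw [lintegral_map (by fun_prop) measurable_swap]
    refine lintegral_mono fun p => ?_
    simp only [Prod.fst_swap, Prod.snd_swap]
    rw [← enorm_neg, neg_sub]

theorem W1_comm (μ ν : ProbabilityMeasure (E d)) : W1 μ ν = W1 ν μ :=
  le_antisymm (W1_le_W1_swap μ ν) (W1_le_W1_swap ν μ)

theorem W1_map_le {μ ν : ProbabilityMeasure (E d)} {q : E d → E d} (hq : Measurable q)
    (h : (μ : Measure (E d)).map q = ν) : W1 μ ν ≤ ∫⁻ x, ‖x - q x‖ₑ ∂(μ : Measure (E d)) := by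
  have hm : Measurable (fun x : E d => (x, q x)) := by fun_prop
  refine (W1_le_of_coupling ((μ : Measure (E d)).map (fun x => (x, q x))) ?_ ?_).trans ?_
  · rw [Measure.map_map measurable_fst hm]; exact Measure.map_id
  · rw [Measure.map_map measurable_snd hm, ← h]; rfl
  · rw [lintegral_map (by fun_prop) hm]

/-- The mass shared by `μ` and `μ'` costs nothing to transport. -/
theorem W1_le_of_common {μ μ' : ProbabilityMeasure (E d)} (ν p q : Measure (E d))
    (h : (μ : Measure (E d)) = ν + p) (h' : (μ' : Measure (E d)) = ν + q) :
    W1 μ μ' ≤ ∫⁻ x, ‖x‖ₑ ∂p + ∫⁻ x, ‖x‖ₑ ∂q := by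
  have hu : ν Set.univ + p Set.univ = 1 := by
    have : (μ : Measure (E d)) Set.univ = 1 := measure_univ
    rwa [h] at this
  have hu' : ν Set.univ + q Set.univ = 1 := by
    have : (μ' : Measure (E d)) Set.univ = 1 := measure_univ
    rwa [h'] at this
  have hν : ν Set.univ ≠ ∞ := ne_top_of_le_ne_top ENNReal.one_ne_top (hu ▸ le_self_add)
  have hp : p Set.univ ≠ ∞ := ne_top_of_le_ne_top ENNReal.one_ne_top (hu ▸ le_add_self)
  have hpq : q Set.univ = p Set.univ := by
    have : ν Set.univ + q Set.univ = ν Set.univ + p Set.univ := by rw [hu, hu']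
    exact (ENNReal.add_right_inj hν).1 this
  have : IsFiniteMeasure p := ⟨hp.lt_top⟩
  have : IsFiniteMeasure q := ⟨by rw [hpq]; exact hp.lt_top⟩
  by_cases h0 : p Set.univ = 0
  · have hp0 : p = 0 := Measure.measure_univ_eq_zero.1 h0
    have hq0 : q = 0 := Measure.measure_univ_eq_zero.1 (hpq.trans h0)
    have hμ : (μ : Measure (E d)).map id = μ' := by rw [Measure.map_id, h, h', hp0, hq0]
    refine (W1_map_le measurable_id hμ).trans ?_
    simp
  set c := (p Set.univ)⁻¹ with hc
  have hcc : c * p Set.univ = 1 := ENNReal.inv_mul_cancel h0 hp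
  have hdiag : Measurable (fun x : E d => (x, x)) := by fun_prop
  -- The common part `ν` stays on the diagonal; `p` and `q`, which have equal mass, are coupled
  -- independently, normalised by that mass.
  refine (W1_le_of_coupling (ν.map (fun x => (x, x)) + c • p.prod q) ?_ ?_).trans ?_
  · rw [Measure.map_add _ _ measurable_fst, Measure.map_map measurable_fst hdiag,
      Measure.map_smul, Measure.map_fst_prod, hpq, smul_smul, hcc, one_smul, h]
    congr 1
    exact Measure.map_id
  · rw [Measure.map_add _ _ measurable_snd, Measure.map_map measurable_snd hdiag,
      Measure.map_smul, Measure.map_snd_prod, smul_smul, hcc, one_smul, h']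
    congr 1
    exact Measure.map_id
  · rw [lintegral_add_measure, lintegral_map (by fun_prop) hdiag, lintegral_smul_measure]
    simp only [sub_self, enorm_zero, lintegral_zero, zero_add, smul_eq_mul]
    calc c * ∫⁻ z, ‖z.1 - z.2‖ₑ ∂(p.prod q)
        ≤ c * ∫⁻ z, (‖z.1‖ₑ + ‖z.2‖ₑ) ∂(p.prod q) := by
          gcongr with z
          exact enorm_sub_le
      _ = c * ((∫⁻ x, ‖x‖ₑ ∂p) * p Set.univ + (∫⁻ x, ‖x‖ₑ ∂q) * p Set.univ) := by
          rw [lintegral_add_left (by fun_prop), lintegral_prod _ (by fun_prop),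
            lintegral_prod _ (by fun_prop)]
          simp only [lintegral_const]
          rw [hpq, lintegral_mul_const _ (by fun_prop)]
      _ = (c * p Set.univ) * (∫⁻ x, ‖x‖ₑ ∂p + ∫⁻ x, ‖x‖ₑ ∂q) := by ring
      _ ≤ _ := by rw [hcc, one_mul]

theorem W1_le_add_moments (μ ν : ProbabilityMeasure (E d)) :
    W1 μ ν ≤ ∫⁻ x, ‖x‖ₑ ∂(μ : Measure (E d)) + ∫⁻ x, ‖x‖ₑ ∂(ν : Measure (E d)) :=
  W1_le_of_common 0 _ _ (zero_add _).symm (zero_add _).symm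

theorem W1_lt_top {μ ν : ProbabilityMeasure (E d)} (hμ : FiniteFirstMoment μ)
    (hν : FiniteFirstMoment ν) : W1 μ ν < ∞ :=
  (W1_le_add_moments μ ν).trans_lt (ENNReal.add_lt_top.2 ⟨hμ, hν⟩)

theorem finiteFirstMoment_diracPM (x : E d) : FiniteFirstMoment (diracPM x) := by
  simp [FiniteFirstMoment, diracPM, lintegral_dirac]

theorem lintegral_empirical {N : ℕ+} (x : Fin N → E d) (g : E d → ℝ≥0∞) :
    ∫⁻ y, g y ∂(empirical x : Measure (E d)) = ((N : ℕ) : ℝ≥0∞)⁻¹ * ∑ i, g (x i) := by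
  simp [empirical, lintegral_smul_measure, lintegral_dirac]

theorem finiteFirstMoment_empirical {N : ℕ+} (x : Fin N → E d) :
    FiniteFirstMoment (empirical x) := by
  rw [FiniteFirstMoment, lintegral_empirical]
  refine ENNReal.mul_lt_top (by simp) ?_
  exact ENNReal.sum_lt_top.2 fun i _ => enorm_lt_top

theorem W1_diracPM_zero_le (μ : ProbabilityMeasure (E d)) :
    W1 μ (diracPM 0) ≤ ∫⁻ x, ‖x‖ₑ ∂(μ : Measure (E d)) := by
  simpa [diracPM, lintegral_dirac] using W1_le_add_moments μ (diracPM 0)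

/-- Translating `μ` by a small nonzero vector produces a different measure close to `μ`. -/
theorem exists_ne_W1_le [NeZero d] {μ : ProbabilityMeasure (E d)} (hμ : FiniteFirstMoment μ)
    {η : ℝ} (hη : 0 < η) :
    ∃ ν : ProbabilityMeasure (E d), ν ≠ μ ∧ FiniteFirstMoment ν ∧
      W1 μ ν ≤ ENNReal.ofReal η := by
  obtain ⟨v, hv⟩ : ∃ v : E d, ‖v‖ = η := by
    refine ⟨EuclideanSpace.single 0 η, ?_⟩
    simp [abs_of_pos hη]
  have hm : Measurable (fun x : E d => x + v) := by fun_prop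
  have hi : Integrable (fun x : E d => x) (μ : Measure (E d)) :=
    ⟨measurable_id.aestronglyMeasurable, hμ⟩
  refine ⟨⟨(μ : Measure (E d)).map (fun x => x + v),
    Measure.isProbabilityMeasure_map hm.aemeasurable⟩, ?_, ?_, ?_⟩
  -- The translation moves the barycentre by `v ≠ 0`, so the two measures differ.
  · intro h
    have h' : (μ : Measure (E d)).map (fun x => x + v) = μ :=
      congrArg (fun ν : ProbabilityMeasure (E d) => (ν : Measure (E d))) h
    have h1 : ∫ x, x ∂((μ : Measure (E d)).map (fun x => x + v)) = ∫ x, x ∂(μ : Measure (E d)) := by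
      rw [h']
    rw [integral_map hm.aemeasurable (f := fun x : E d => x) measurable_id.aestronglyMeasurable,
      integral_add hi (integrable_const v)] at h1
    simp at h1
    rw [h1, norm_zero] at hv
    exact hη.ne hv
  · unfold FiniteFirstMoment
    simp only [ProbabilityMeasure.coe_mk]
    rw [lintegral_map (by fun_prop) hm]
    refine (lintegral_mono fun x => enorm_add_le x v).trans_lt ?_
    rw [lintegral_add_left (by fun_prop)]
    simp only [lintegral_const, measure_univ, mul_one]
    exact ENNReal.add_lt_top.2 ⟨hμ, enorm_lt_top⟩
  · refine (W1_map_le hm rfl).trans ?_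
    simp [enorm_eq_nnnorm, ← hv]

end Wasserstein

/-! ### Lipschitz estimates and contraction of the nonlinear flow -/

namespace Model

variable {d m : ℕ} (S : Model d m)

theorem enorm_f_sub_le_of_ne {z : E m} {x₁ x₂ : E d} {μ₁ μ₂ : ProbabilityMeasure (E d)}
    (hx : x₁ ≠ x₂) (hμ : μ₁ ≠ μ₂) (h₁ : FiniteFirstMoment μ₁) (h₂ : FiniteFirstMoment μ₂) :
    ‖S.f x₁ μ₁ z - S.f x₂ μ₂ z‖ₑ ≤ S.D z * (‖x₁ - x₂‖ₑ + W1 μ₁ μ₂) := by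
  have h0 : ‖x₁ - x₂‖ₑ + W1 μ₁ μ₂ ≠ 0 := by
    intro h
    rw [add_eq_zero, enorm_eq_zero, sub_eq_zero] at h
    exact hx h.1
  have ht : ‖x₁ - x₂‖ₑ + W1 μ₁ μ₂ ≠ ∞ :=
    ENNReal.add_ne_top.2 ⟨enorm_ne_top, (W1_lt_top h₁ h₂).ne⟩
  rw [← ENNReal.div_le_iff h0 ht]
  exact le_iSup_of_le x₁ <| le_iSup_of_le x₂ <| le_iSup_of_le μ₁ <| le_iSup_of_le μ₂ <|
    le_iSup_of_le ⟨hx, hμ, h₁, h₂⟩ le_rfl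

/-- The definition of `D` only allows both arguments to change at once. Go from `(x₁, μ)` to
`(midpoint, ν)` and on to `(x₂, μ)`, with `ν ≠ μ` at distance at most `η`: the two spatial distances
add up to `|x₁ - x₂|`, and the detour through `ν` costs `2 η D(z)`, which vanishes as `η → 0`
because `D(z)` is finite. -/
theorem enorm_f_sub_le_of_ne_left [NeZero d] {z : E m} (hz : S.D z ≠ ∞) {x₁ x₂ : E d}
    {μ : ProbabilityMeasure (E d)} (hx : x₁ ≠ x₂) (hμ : FiniteFirstMoment μ) :
    ‖S.f x₁ μ z - S.f x₂ μ z‖ₑ ≤ S.D z * ‖x₁ - x₂‖ₑ := by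
  have key : ∀ η : ℝ, 0 < η → ‖S.f x₁ μ z - S.f x₂ μ z‖ₑ ≤
      S.D z * (‖x₁ - x₂‖ₑ + 2 * ENNReal.ofReal η) := by
    intro η hη
    obtain ⟨ν, hne, hν, hW⟩ := exists_ne_W1_le hμ hη
    set y := midpoint ℝ x₁ x₂ with hy
    have hy1 : ‖x₁ - y‖ₑ + ‖y - x₂‖ₑ = ‖x₁ - x₂‖ₑ := by
      rw [← ofReal_norm, ← ofReal_norm, ← ofReal_norm,
        ← ENNReal.ofReal_add (norm_nonneg _) (norm_nonneg _), ← dist_eq_norm, ← dist_eq_norm,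
        dist_left_midpoint, dist_midpoint_right, ← dist_eq_norm]
      congr 1
      norm_num
      ring
    have h1 := S.enorm_f_sub_le_of_ne (z := z) (x₁ := x₁) (x₂ := y) (μ₁ := μ) (μ₂ := ν)
      (fun h => hx ((left_eq_midpoint_iff ℝ).1 h)) hne.symm hμ hν
    have h2 := S.enorm_f_sub_le_of_ne (z := z) (x₁ := y) (x₂ := x₂) (μ₁ := ν) (μ₂ := μ)
      (fun h => hx ((midpoint_eq_right_iff ℝ).1 h)) hne hν hμ
    rw [W1_comm ν μ] at h2
    calc ‖S.f x₁ μ z - S.f x₂ μ z‖ₑ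
        = ‖(S.f x₁ μ z - S.f y ν z) + (S.f y ν z - S.f x₂ μ z)‖ₑ := by congr 1; abel
      _ ≤ ‖S.f x₁ μ z - S.f y ν z‖ₑ + ‖S.f y ν z - S.f x₂ μ z‖ₑ := enorm_add_le _ _
      _ ≤ S.D z * (‖x₁ - y‖ₑ + W1 μ ν) + S.D z * (‖y - x₂‖ₑ + W1 μ ν) := add_le_add h1 h2
      _ = S.D z * ((‖x₁ - y‖ₑ + ‖y - x₂‖ₑ) + 2 * W1 μ ν) := by ring
      _ ≤ _ := by rw [hy1]; gcongr
  have hlim : Filter.Tendsto (fun η : ℝ => S.D z * (‖x₁ - x₂‖ₑ + 2 * ENNReal.ofReal η))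
      (nhdsWithin 0 (Set.Ioi 0)) (nhds (S.D z * (‖x₁ - x₂‖ₑ + 2 * ENNReal.ofReal 0))) := by
    refine Filter.Tendsto.mono_left ?_ nhdsWithin_le_nhds
    refine ENNReal.Tendsto.const_mul ?_ (Or.inr hz)
    refine tendsto_const_nhds.add (ENNReal.Tendsto.const_mul ?_ (Or.inr (by simp)))
    exact (ENNReal.continuous_ofReal.tendsto 0)
  have := ge_of_tendsto hlim (Filter.eventually_of_mem self_mem_nhdsWithin key)
  simpa using this

/-- The supremum defining `D` runs over pairs differing in both arguments; the Lipschitz bound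
nevertheless holds for all pairs. -/
theorem enorm_f_sub_le [NeZero d] {z : E m} (hz : S.D z ≠ ∞) (x₁ x₂ : E d)
    {μ₁ μ₂ : ProbabilityMeasure (E d)} (h₁ : FiniteFirstMoment μ₁) (h₂ : FiniteFirstMoment μ₂) :
    ‖S.f x₁ μ₁ z - S.f x₂ μ₂ z‖ₑ ≤ S.D z * (‖x₁ - x₂‖ₑ + W1 μ₁ μ₂) := by
  by_cases hμ : μ₁ = μ₂
  · subst hμ
    by_cases hx : x₁ = x₂
    · simp [hx]
    · exact (S.enorm_f_sub_le_of_ne_left hz hx h₁).trans (by gcongr; exact le_self_add)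
  by_cases hx : x₁ = x₂
  swap
  · exact S.enorm_f_sub_le_of_ne hx hμ h₁ h₂
  subst hx
  -- Same points, different measures: move to `x₁ + v` with `|v| = η` while changing the measure,
  -- then return to `x₁` with the measure fixed.
  have key : ∀ η : ℝ, 0 < η → ‖S.f x₁ μ₁ z - S.f x₁ μ₂ z‖ₑ ≤
      S.D z * (W1 μ₁ μ₂ + 2 * ENNReal.ofReal η) := by
    intro η hη
    set v : E d := EuclideanSpace.single 0 η with hv
    have hvn : ‖v‖ₑ = ENNReal.ofReal η := by
      rw [← ofReal_norm]; simp [hv, abs_of_pos hη]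
    have hv0 : v ≠ 0 := by
      intro h; rw [h, enorm_zero] at hvn
      exact (ENNReal.ofReal_pos.2 hη).ne hvn
    have h1 := S.enorm_f_sub_le_of_ne (z := z) (x₁ := x₁) (x₂ := x₁ + v) (μ₁ := μ₁) (μ₂ := μ₂)
      (by simpa using hv0) hμ h₁ h₂
    have h2 := S.enorm_f_sub_le_of_ne_left hz (x₁ := x₁ + v) (x₂ := x₁) (μ := μ₂)
      (by simpa using hv0) h₂
    have e1 : x₁ - (x₁ + v) = -v := by abel
    have e2 : x₁ + v - x₁ = v := by abel
    rw [e1, enorm_neg, hvn] at h1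
    rw [e2, hvn] at h2
    calc ‖S.f x₁ μ₁ z - S.f x₁ μ₂ z‖ₑ
        = ‖(S.f x₁ μ₁ z - S.f (x₁ + v) μ₂ z) + (S.f (x₁ + v) μ₂ z - S.f x₁ μ₂ z)‖ₑ := by
          congr 1; abel
      _ ≤ _ := enorm_add_le _ _
      _ ≤ _ := add_le_add h1 h2
      _ = _ := by ring
  have hlim : Filter.Tendsto (fun η : ℝ => S.D z * (W1 μ₁ μ₂ + 2 * ENNReal.ofReal η))
      (nhdsWithin 0 (Set.Ioi 0)) (nhds (S.D z * (W1 μ₁ μ₂ + 2 * ENNReal.ofReal 0))) := by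
    refine Filter.Tendsto.mono_left ?_ nhdsWithin_le_nhds
    refine ENNReal.Tendsto.const_mul ?_ (Or.inr hz)
    refine tendsto_const_nhds.add (ENNReal.Tendsto.const_mul ?_ (Or.inr (by simp)))
    exact (ENNReal.continuous_ofReal.tendsto 0)
  have := ge_of_tendsto hlim (Filter.eventually_of_mem self_mem_nhdsWithin key)
  simpa using this

theorem measurable_f_noise (x : E d) (μ : ProbabilityMeasure (E d)) :
    Measurable (fun z => S.f x μ z) :=
  S.measurable_f.comp (measurable_const.prodMk (measurable_const.prodMk measurable_id))

theorem measurable_D₁ : Measurable S.D₁ := (S.measurable_f_noise _ _).norm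

theorem sigma_nonneg : 0 ≤ S.σ := ENNReal.toReal_nonneg

theorem ae_D_ne_top {M : ℝ}
    (hD : ∀ᵐ z ∂(S.θ : Measure (E m)), S.D z ≤ ENNReal.ofReal M) :
    ∀ᵐ z ∂(S.θ : Measure (E m)), S.D z ≠ ∞ := by
  filter_upwards [hD] with z hz using ne_top_of_le_ne_top ENNReal.ofReal_ne_top hz

/-- The essential bound on `D` excludes the value `∞`, at which `toReal` would make `σ` equal to
`0`. -/
theorem lintegral_D {M : ℝ}
    (hD : ∀ᵐ z ∂(S.θ : Measure (E m)), S.D z ≤ ENNReal.ofReal M) :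
    ∫⁻ z, S.D z ∂(S.θ : Measure (E m)) = ENNReal.ofReal S.σ := by
  rw [σ, ENNReal.ofReal_toReal]
  refine ne_top_of_le_ne_top (b := ENNReal.ofReal M) ENNReal.ofReal_ne_top ?_
  refine (lintegral_mono_ae hD).trans ?_
  simp

theorem lintegral_enorm_f_sub_le [NeZero d] {M : ℝ}
    (hD : ∀ᵐ z ∂(S.θ : Measure (E m)), S.D z ≤ ENNReal.ofReal M) (x₁ x₂ : E d)
    {μ₁ μ₂ : ProbabilityMeasure (E d)} (h₁ : FiniteFirstMoment μ₁) (h₂ : FiniteFirstMoment μ₂) :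
    ∫⁻ z, ‖S.f x₁ μ₁ z - S.f x₂ μ₂ z‖ₑ ∂(S.θ : Measure (E m)) ≤
      ENNReal.ofReal S.σ * (‖x₁ - x₂‖ₑ + W1 μ₁ μ₂) := by
  -- `D` is an uncountable supremum whose measurability is not known; a finite constant can be
  -- pulled out of the integral without it.
  rw [← S.lintegral_D hD, ← lintegral_mul_const' _ _
    (ENNReal.add_ne_top.2 ⟨enorm_ne_top, (W1_lt_top h₁ h₂).ne⟩)]
  refine lintegral_mono_ae ?_
  filter_upwards [S.ae_D_ne_top hD] with z hz using S.enorm_f_sub_le hz _ _ h₁ h₂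

/-- Synchronous coupling: start from a coupling of `μ` and `ν` and feed the same noise to both
copies. One `δσ` in the factor comes from the dependence of `f` on the position, the other from its
dependence on the measure. -/
theorem W1_Psi_le [NeZero d] {M : ℝ}
    (hD : ∀ᵐ z ∂(S.θ : Measure (E m)), S.D z ≤ ENNReal.ofReal M)
    {ω : ℝ} (hA : ‖S.A‖ ≤ Real.exp (-ω)) (hδ : 0 ≤ S.δ)
    {μ ν : ProbabilityMeasure (E d)} (hμ : FiniteFirstMoment μ) (hν : FiniteFirstMoment ν) :
    W1 (S.Psi μ) (S.Psi ν) ≤ ENNReal.ofReal (Real.exp (-ω) + 2 * S.δ * S.σ) * W1 μ ν := by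
  have hκ : 0 < Real.exp (-ω) + 2 * S.δ * S.σ := by
    have := S.sigma_nonneg
    positivity
  set k := ENNReal.ofReal (Real.exp (-ω) + 2 * S.δ * S.σ) with hk
  have hk0 : k ≠ 0 := (ENNReal.ofReal_pos.2 hκ).ne'
  have hkt : k ≠ ∞ := ENNReal.ofReal_ne_top
  -- With `k` on the left, the infimum on the right can be tested against an arbitrary coupling `π`,
  -- so no optimal coupling is needed.
  rw [mul_comm, ← ENNReal.div_le_iff hk0 hkt]
  refine le_iInf₂ ?_
  rintro π ⟨h₁, h₂⟩
  have hπ : IsProbabilityMeasure π := isProbabilityMeasure_of_map_eq measurable_fst h₁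
  have hWπ : W1 μ ν ≤ ∫⁻ p, ‖p.1 - p.2‖ₑ ∂π := W1_le_of_coupling π h₁ h₂
  rw [ENNReal.div_le_iff hk0 hkt]
  have hm : Measurable (fun p : (E d × E d) × E m => (S.step p.1.1 μ p.2, S.step p.1.2 ν p.2)) :=
    ((S.measurable_step μ).comp (by fun_prop : Measurable fun p : (E d × E d) × E m =>
      (p.1.1, p.2))).prodMk ((S.measurable_step ν).comp
      (by fun_prop : Measurable fun p : (E d × E d) × E m => (p.1.2, p.2)))
  have e1 : (μ : Measure (E d)).prod (S.θ : Measure (E m)) =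
      (π.prod (S.θ : Measure (E m))).map (fun p => (p.1.1, p.2)) := by
    have := Measure.map_prod_map π (S.θ : Measure (E m)) measurable_fst measurable_id
    rw [h₁, Measure.map_id] at this
    exact this
  have e2 : (ν : Measure (E d)).prod (S.θ : Measure (E m)) =
      (π.prod (S.θ : Measure (E m))).map (fun p => (p.1.2, p.2)) := by
    have := Measure.map_prod_map π (S.θ : Measure (E m)) measurable_snd measurable_id
    rw [h₂, Measure.map_id] at this
    exact this
  refine (W1_le_of_coupling ((π.prod (S.θ : Measure (E m))).map
    fun p => (S.step p.1.1 μ p.2, S.step p.1.2 ν p.2)) ?_ ?_ (μ := S.Psi μ)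
    (ν := S.Psi ν)).trans ?_
  · rw [Measure.map_map measurable_fst hm]
    simp only [Psi, ProbabilityMeasure.coe_mk]
    rw [e1, Measure.map_map (S.measurable_step μ) (by fun_prop)]
    rfl
  · rw [Measure.map_map measurable_snd hm]
    simp only [Psi, ProbabilityMeasure.coe_mk]
    rw [e2, Measure.map_map (S.measurable_step ν) (by fun_prop)]
    rfl
  rw [lintegral_map (by fun_prop) hm, lintegral_prod _ (by fun_prop)]
  have hpt : ∀ p : E d × E d, ∫⁻ z, ‖S.step p.1 μ z - S.step p.2 ν z‖ₑ ∂(S.θ : Measure (E m)) ≤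
      ENNReal.ofReal (Real.exp (-ω)) * ‖p.1 - p.2‖ₑ +
        ENNReal.ofReal (S.δ * S.σ) * (‖p.1 - p.2‖ₑ + W1 μ ν) := by
    intro p
    calc ∫⁻ z, ‖S.step p.1 μ z - S.step p.2 ν z‖ₑ ∂(S.θ : Measure (E m))
        ≤ ∫⁻ z, (ENNReal.ofReal (Real.exp (-ω)) * ‖p.1 - p.2‖ₑ +
            ENNReal.ofReal S.δ * ‖S.f p.1 μ z - S.f p.2 ν z‖ₑ) ∂(S.θ : Measure (E m)) := by
          refine lintegral_mono fun z => ?_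
          have : S.step p.1 μ z - S.step p.2 ν z =
              S.A (p.1 - p.2) + S.δ • (S.f p.1 μ z - S.f p.2 ν z) := by
            simp only [step, map_sub, smul_sub]; abel
          simp only [this]
          refine (enorm_add_le _ _).trans (add_le_add ?_ ?_)
          · rw [← ofReal_norm, ← ofReal_norm,
              ← ENNReal.ofReal_mul (Real.exp_pos _).le]
            exact ENNReal.ofReal_le_ofReal ((S.A.le_opNorm _).trans (by gcongr))
          · rw [enorm_smul, Real.enorm_of_nonneg hδ]
      _ = ENNReal.ofReal (Real.exp (-ω)) * ‖p.1 - p.2‖ₑ + ENNReal.ofReal S.δ *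
            ∫⁻ z, ‖S.f p.1 μ z - S.f p.2 ν z‖ₑ ∂(S.θ : Measure (E m)) := by
          rw [lintegral_add_left measurable_const, lintegral_const, measure_univ, mul_one,
            lintegral_const_mul]
          exact ((S.measurable_f_noise _ _).sub (S.measurable_f_noise _ _)).enorm
      _ ≤ ENNReal.ofReal (Real.exp (-ω)) * ‖p.1 - p.2‖ₑ + ENNReal.ofReal S.δ *
            (ENNReal.ofReal S.σ * (‖p.1 - p.2‖ₑ + W1 μ ν)) := by
          gcongr
          exact S.lintegral_enorm_f_sub_le hD _ _ hμ hν
      _ = _ := by rw [ENNReal.ofReal_mul hδ, mul_assoc]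
  refine (lintegral_mono hpt).trans ?_
  rw [lintegral_add_left (by fun_prop), lintegral_const_mul _ (by fun_prop),
    lintegral_const_mul _ (by fun_prop), lintegral_add_right _ measurable_const, lintegral_const,
    measure_univ, mul_one]
  set I := ∫⁻ p, ‖p.1 - p.2‖ₑ ∂π
  calc _ ≤ ENNReal.ofReal (Real.exp (-ω)) * I + ENNReal.ofReal (S.δ * S.σ) * (I + I) := by gcongr
    _ = (ENNReal.ofReal (Real.exp (-ω)) + ENNReal.ofReal (S.δ * S.σ) +
          ENNReal.ofReal (S.δ * S.σ)) * I := by ring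
    _ = I * k := by
      have := S.sigma_nonneg
      rw [← ENNReal.ofReal_add (by positivity) (by positivity),
        ← ENNReal.ofReal_add (by positivity) (by positivity), hk, mul_comm]
      congr 2
      ring

end Model

/-! ### Exponential moments -/

/-- The exponential moment `∫ e^{λ|x|} μ(dx)`. -/
def expMoment {d : ℕ} (lam : ℝ) (μ : ProbabilityMeasure (E d)) : ℝ≥0∞ :=
  ∫⁻ x, ENNReal.ofReal (Real.exp (lam * ‖x‖)) ∂(μ : Measure (E d))

section

variable {d : ℕ} {lam : ℝ} {μ : ProbabilityMeasure (E d)}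

theorem integrable_exp_of_expMoment_ne_top (h : expMoment lam μ ≠ ∞) :
    Integrable (fun x => Real.exp (lam * ‖x‖)) (μ : Measure (E d)) := by
  refine ⟨by fun_prop, ?_⟩
  rw [hasFiniteIntegral_iff_ofReal (Filter.Eventually.of_forall fun x => (Real.exp_pos _).le)]
  exact h.lt_top

theorem integrable_norm_of_expMoment_ne_top (hlam : 0 < lam) (h : expMoment lam μ ≠ ∞) :
    Integrable (fun x => ‖x‖) (μ : Measure (E d)) := by
  refine ((integrable_exp_of_expMoment_ne_top h).const_mul lam⁻¹).mono' (by fun_prop) ?_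
  refine Filter.Eventually.of_forall fun x => ?_
  rw [norm_norm, ← div_eq_inv_mul, le_div_iff₀ hlam, mul_comm]
  linarith [Real.add_one_le_exp (lam * ‖x‖)]

theorem finiteFirstMoment_of_expMoment_ne_top (hlam : 0 < lam) (h : expMoment lam μ ≠ ∞) :
    FiniteFirstMoment μ := by
  have := (integrable_norm_of_expMoment_ne_top hlam h).2
  simpa [HasFiniteIntegral, FiniteFirstMoment] using this

theorem exp_integral_norm_le_expMoment (hlam : 0 < lam) (h : expMoment lam μ ≠ ∞) :
    ENNReal.ofReal (Real.exp (lam * ∫ x, ‖x‖ ∂(μ : Measure (E d)))) ≤ expMoment lam μ := by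
  have hi := integrable_exp_of_expMoment_ne_top h
  rw [expMoment, ← ofReal_integral_eq_lintegral_ofReal hi
    (Filter.Eventually.of_forall fun x => (Real.exp_pos _).le)]
  refine ENNReal.ofReal_le_ofReal ?_
  rw [← integral_const_mul]
  exact convexOn_exp.map_integral_le Real.continuous_exp.continuousOn isClosed_univ
    (Filter.Eventually.of_forall fun x => Set.mem_univ _)
    ((integrable_norm_of_expMoment_ne_top hlam h).const_mul lam) hi

theorem expMoment_empirical_ne_top {N : ℕ+} (x : Fin N → E d) :
    expMoment lam (empirical x) ≠ ∞ := by
  rw [expMoment, lintegral_empirical]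
  refine (ENNReal.mul_lt_top (by simp) ?_).ne
  exact ENNReal.sum_lt_top.2 fun i _ => ENNReal.ofReal_lt_top

end

/-- Jensen's inequality for `exp` with three weights. -/
theorem exp_le_of_le_convex_combination {w₁ w₂ w₃ t₁ t₂ t₃ t : ℝ} (h₁ : 0 ≤ w₁) (h₂ : 0 ≤ w₂)
    (h₃ : 0 ≤ w₃) (hw : w₁ + w₂ + w₃ = 1) (ht : t ≤ w₁ * t₁ + w₂ * t₂ + w₃ * t₃) :
    Real.exp t ≤ w₁ * Real.exp t₁ + w₂ * Real.exp t₂ + w₃ * Real.exp t₃ := by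
  set s := w₁ * t₁ + w₂ * t₂ + w₃ * t₃ with hs
  -- Tangent line of `exp` at the weighted mean `s`; averaging it over the three points returns `exp
  -- s`.
  have key : ∀ u, Real.exp s * (u - s + 1) ≤ Real.exp u := by
    intro u
    have : Real.exp u = Real.exp s * Real.exp (u - s) := by rw [← Real.exp_add]; congr 1; ring
    rw [this]
    exact mul_le_mul_of_nonneg_left (Real.add_one_le_exp _) (Real.exp_pos _).le
  have e : Real.exp s = w₁ * (Real.exp s * (t₁ - s + 1)) + w₂ * (Real.exp s * (t₂ - s + 1)) +
      w₃ * (Real.exp s * (t₃ - s + 1)) := by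
    have : w₃ = 1 - w₁ - w₂ := by linarith
    have h' : (w₁ * t₁ + w₂ * t₂ + w₃ * t₃) - (w₁ + w₂ + w₃) * s + (w₁ + w₂ + w₃) = 1 := by
      rw [hw, ← hs]; ring
    calc Real.exp s = Real.exp s *
          ((w₁ * t₁ + w₂ * t₂ + w₃ * t₃) - (w₁ + w₂ + w₃) * s + (w₁ + w₂ + w₃)) := by
          rw [h', mul_one]
      _ = _ := by ring
  calc Real.exp t ≤ Real.exp s := Real.exp_le_exp.2 ht
    _ = _ := e
    _ ≤ _ := by gcongr <;> exact key _

namespace Model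

variable {d m : ℕ} (S : Model d m)

/-- Compare `f(x, μ, z)` with `f(0, δ₀, z)`, using that `W1(μ, δ₀)` is at most the first absolute
moment of `μ`. -/
theorem norm_step_le [NeZero d] {ω : ℝ} (hA : ‖S.A‖ ≤ Real.exp (-ω)) (hδ : 0 ≤ S.δ) {M : ℝ}
    (hM : 0 ≤ M) {z : E m} (hz : S.D z ≤ ENNReal.ofReal M) (x : E d)
    {μ : ProbabilityMeasure (E d)} (hμ : Integrable (fun x => ‖x‖) (μ : Measure (E d))) :
    ‖S.step x μ z‖ ≤ Real.exp (-ω) * ‖x‖ +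
      S.δ * (M * (‖x‖ + ∫ y, ‖y‖ ∂(μ : Measure (E d))) + S.D₁ z) := by
  set a := ∫ y, ‖y‖ ∂(μ : Measure (E d)) with ha
  have ha0 : 0 ≤ a := integral_nonneg fun _ => norm_nonneg _
  have hmu : ∫⁻ y, ‖y‖ₑ ∂(μ : Measure (E d)) = ENNReal.ofReal a := by
    rw [ha, ofReal_integral_eq_lintegral_ofReal hμ
      (Filter.Eventually.of_forall fun _ => norm_nonneg _)]
    simp
  have hfin : FiniteFirstMoment μ := by rw [FiniteFirstMoment, hmu]; exact ENNReal.ofReal_lt_top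
  have h1 : ‖S.f x μ z - S.f 0 (diracPM 0) z‖ ≤ M * (‖x‖ + a) := by
    have h := S.enorm_f_sub_le (ne_top_of_le_ne_top ENNReal.ofReal_ne_top hz) x 0 hfin
      (finiteFirstMoment_diracPM 0)
    have h' : ‖S.f x μ z - S.f 0 (diracPM 0) z‖ₑ ≤ ENNReal.ofReal (M * (‖x‖ + a)) := by
      refine h.trans ?_
      rw [ENNReal.ofReal_mul hM, ENNReal.ofReal_add (norm_nonneg _) ha0, sub_zero, ofReal_norm,
        ← hmu]
      gcongr
      exact W1_diracPM_zero_le μ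
    rw [← ofReal_norm] at h'
    exact (ENNReal.ofReal_le_ofReal_iff (by positivity)).1 h'
  have h2 : ‖S.f x μ z‖ ≤ M * (‖x‖ + a) + S.D₁ z := by
    have := norm_add_le (S.f x μ z - S.f 0 (diracPM 0) z) (S.f 0 (diracPM 0) z)
    rw [sub_add_cancel] at this
    rw [D₁]
    linarith
  calc ‖S.step x μ z‖ ≤ ‖S.A x‖ + ‖S.δ • S.f x μ z‖ := norm_add_le _ _
    _ ≤ ‖S.A‖ * ‖x‖ + S.δ * ‖S.f x μ z‖ := by
      rw [norm_smul, Real.norm_of_nonneg hδ]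
      gcongr
      exact S.A.le_opNorm x
    _ ≤ _ := by gcongr

/-- By `norm_step_le`, `λ|step|` is at most a combination of `λ|x|`, `λ∫|y|dμ` and `α D₁(z)` with
weights `e^{-ω} + δM`, `δM` and `1 - ρ`, which sum to one; the condition on `lam * S.δ` lets the
last weight absorb the `D₁` term. Convexity of `exp`, with Jensen's inequality for the mean-field
term, makes the first two contributions add up to `ρ` times the moment of `μ`. -/
theorem expMoment_Psi_le [NeZero d] {ω : ℝ} (hA : ‖S.A‖ ≤ Real.exp (-ω)) (hδ : 0 ≤ S.δ) {M : ℝ}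
    (hM : 0 ≤ M) (hD : ∀ᵐ z ∂(S.θ : Measure (E m)), S.D z ≤ ENNReal.ofReal M)
    (hρ : Real.exp (-ω) + 2 * S.δ * M < 1) {α lam : ℝ} (hlam : 0 < lam)
    (hlα : lam * S.δ ≤ α * (1 - (Real.exp (-ω) + 2 * S.δ * M)))
    {μ : ProbabilityMeasure (E d)} (hμ : expMoment lam μ ≠ ∞) :
    expMoment lam (S.Psi μ) ≤ ENNReal.ofReal (Real.exp (-ω) + 2 * S.δ * M) * expMoment lam μ +
      ENNReal.ofReal (1 - (Real.exp (-ω) + 2 * S.δ * M)) *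
        ∫⁻ z, ENNReal.ofReal (Real.exp (α * S.D₁ z)) ∂(S.θ : Measure (E m)) := by
  set ρ := Real.exp (-ω) + 2 * S.δ * M with hρ'
  set a := ∫ y, ‖y‖ ∂(μ : Measure (E d)) with ha
  have hint := integrable_norm_of_expMoment_ne_top hlam hμ
  set w₁ := Real.exp (-ω) + S.δ * M with hw₁
  set w₂ := S.δ * M with hw₂
  have hw₁0 : 0 ≤ w₁ := by positivity
  have hw₂0 : 0 ≤ w₂ := by positivity
  have hw₃0 : 0 < 1 - ρ := by linarith
  have hpt : ∀ᵐ z ∂(S.θ : Measure (E m)), ∀ x : E d,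
      ENNReal.ofReal (Real.exp (lam * ‖S.step x μ z‖)) ≤
        ENNReal.ofReal w₁ * ENNReal.ofReal (Real.exp (lam * ‖x‖)) +
          ENNReal.ofReal w₂ * expMoment lam μ +
          ENNReal.ofReal (1 - ρ) * ENNReal.ofReal (Real.exp (α * S.D₁ z)) := by
    filter_upwards [hD] with z hz x
    have h1 := S.norm_step_le hA hδ hM hz x hint
    have hD1 : 0 ≤ S.D₁ z := norm_nonneg _
    have h2 : lam * ‖S.step x μ z‖ ≤
        w₁ * (lam * ‖x‖) + w₂ * (lam * a) + (1 - ρ) * (α * S.D₁ z) := by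
      have := mul_le_mul_of_nonneg_left h1 hlam.le
      have h3 := mul_le_mul_of_nonneg_right hlα hD1
      rw [hw₁, hw₂]
      nlinarith
    have h3 := exp_le_of_le_convex_combination hw₁0 hw₂0 hw₃0.le (by rw [hw₁, hw₂, hρ']; ring) h2
    calc ENNReal.ofReal (Real.exp (lam * ‖S.step x μ z‖))
        ≤ ENNReal.ofReal (w₁ * Real.exp (lam * ‖x‖) + w₂ * Real.exp (lam * a) +
            (1 - ρ) * Real.exp (α * S.D₁ z)) := ENNReal.ofReal_le_ofReal h3
      _ = ENNReal.ofReal w₁ * ENNReal.ofReal (Real.exp (lam * ‖x‖)) +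
          ENNReal.ofReal w₂ * ENNReal.ofReal (Real.exp (lam * a)) +
          ENNReal.ofReal (1 - ρ) * ENNReal.ofReal (Real.exp (α * S.D₁ z)) := by
          rw [ENNReal.ofReal_add (by positivity) (by positivity),
            ENNReal.ofReal_add (by positivity) (by positivity), ENNReal.ofReal_mul hw₁0,
            ENNReal.ofReal_mul hw₂0, ENNReal.ofReal_mul hw₃0.le]
      _ ≤ _ := by
          gcongr
          exact exp_integral_norm_le_expMoment hlam hμ
  have hmeas : Measurable (fun x : E d => ENNReal.ofReal (Real.exp (lam * ‖x‖))) := by fun_prop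
  have hmD : Measurable (fun z => ENNReal.ofReal (Real.exp (α * S.D₁ z))) := by
    have := S.measurable_D₁
    fun_prop
  have hms := S.measurable_step μ
  calc expMoment lam (S.Psi μ)
      = ∫⁻ x, ∫⁻ z, ENNReal.ofReal (Real.exp (lam * ‖S.step x μ z‖)) ∂(S.θ : Measure (E m))
          ∂(μ : Measure (E d)) := by
        rw [expMoment, Psi]
        simp only [ProbabilityMeasure.coe_mk]
        rw [lintegral_map hmeas hms]
        exact lintegral_prod _ (hmeas.comp hms).aemeasurable
    _ ≤ ∫⁻ x, ∫⁻ z, (ENNReal.ofReal w₁ * ENNReal.ofReal (Real.exp (lam * ‖x‖)) +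
          ENNReal.ofReal w₂ * expMoment lam μ +
          ENNReal.ofReal (1 - ρ) * ENNReal.ofReal (Real.exp (α * S.D₁ z)))
          ∂(S.θ : Measure (E m)) ∂(μ : Measure (E d)) := by
        refine lintegral_mono fun x => lintegral_mono_ae ?_
        filter_upwards [hpt] with z hz using hz x
    _ = ENNReal.ofReal w₁ * expMoment lam μ + ENNReal.ofReal w₂ * expMoment lam μ +
          ENNReal.ofReal (1 - ρ) *
            ∫⁻ z, ENNReal.ofReal (Real.exp (α * S.D₁ z)) ∂(S.θ : Measure (E m)) := by
        have : ∀ x : E d, ∫⁻ z, (ENNReal.ofReal w₁ * ENNReal.ofReal (Real.exp (lam * ‖x‖)) +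
          ENNReal.ofReal w₂ * expMoment lam μ +
          ENNReal.ofReal (1 - ρ) * ENNReal.ofReal (Real.exp (α * S.D₁ z)))
          ∂(S.θ : Measure (E m)) = ENNReal.ofReal w₁ * ENNReal.ofReal (Real.exp (lam * ‖x‖)) +
          (ENNReal.ofReal w₂ * expMoment lam μ + ENNReal.ofReal (1 - ρ) *
            ∫⁻ z, ENNReal.ofReal (Real.exp (α * S.D₁ z)) ∂(S.θ : Measure (E m))) := by
          intro x
          rw [lintegral_add_left measurable_const, lintegral_const, measure_univ, mul_one,
            lintegral_const_mul _ hmD, add_assoc]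
        simp only [this]
        rw [lintegral_add_right _ measurable_const, lintegral_const, measure_univ, mul_one,
          lintegral_const_mul _ hmeas, ← add_assoc]
        rfl
    _ = _ := by
        rw [← add_mul, ← ENNReal.ofReal_add hw₁0 hw₂0]
        congr 3
        rw [hw₁, hw₂, hρ']
        ring

/-! ### Iterating the nonlinear flow and telescoping the error -/

theorem law_succ (μ₀ : ProbabilityMeasure (E d)) (n : ℕ) :
    S.law μ₀ (n + 1) = S.Psi (S.law μ₀ n) :=
  Function.iterate_succ_apply' _ _ _

theorem finiteFirstMoment_law [NeZero d] {ω : ℝ} (hA : ‖S.A‖ ≤ Real.exp (-ω)) (hδ : 0 ≤ S.δ)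
    {M : ℝ} (hM : 0 ≤ M) (hD : ∀ᵐ z ∂(S.θ : Measure (E m)), S.D z ≤ ENNReal.ofReal M)
    (hρ : Real.exp (-ω) + 2 * S.δ * M < 1) {α lam : ℝ} (hlam : 0 < lam)
    (hlα : lam * S.δ ≤ α * (1 - (Real.exp (-ω) + 2 * S.δ * M)))
    (hD₁ : ∫⁻ z, ENNReal.ofReal (Real.exp (α * S.D₁ z)) ∂(S.θ : Measure (E m)) ≠ ∞)
    {μ₀ : ProbabilityMeasure (E d)} (hμ₀ : expMoment lam μ₀ ≠ ∞) (n : ℕ) :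
    FiniteFirstMoment (S.law μ₀ n) := by
  refine finiteFirstMoment_of_expMoment_ne_top hlam ?_
  induction n with
  | zero => exact hμ₀
  | succ n ih =>
    rw [law_succ]
    refine ne_top_of_le_ne_top ?_ (S.expMoment_Psi_le hA hδ hM hD hρ hlam hlα ih)
    exact ENNReal.add_ne_top.2 ⟨ENNReal.mul_ne_top ENNReal.ofReal_ne_top ih,
      ENNReal.mul_ne_top ENNReal.ofReal_ne_top hD₁⟩

/-- The distance between the empirical measure at time `n + 1` and its conditional mean. -/
def fluctuation {N : ℕ+} (x₀ : Fin N → E d) (ε : ℕ → Fin N → E m) (n : ℕ) : ℝ≥0∞ :=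
  W1 (empirical (S.particles x₀ ε (n + 1))) (S.Psi (empirical (S.particles x₀ ε n)))

/-- Insert `Ψ(μ_n^N)` by the triangle inequality and contract. The term of lag `j` is the error
created between times `n - 1 - j` and `n - j`, damped by the `j` later steps; only `j < n` occurs,
so the natural-number subtraction never truncates. -/
theorem W1_particles_le [NeZero d] {M : ℝ}
    (hD : ∀ᵐ z ∂(S.θ : Measure (E m)), S.D z ≤ ENNReal.ofReal M)
    {ω : ℝ} (hA : ‖S.A‖ ≤ Real.exp (-ω)) (hδ : 0 ≤ S.δ) {μ₀ : ProbabilityMeasure (E d)}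
    (hμ : ∀ n, FiniteFirstMoment (S.law μ₀ n)) {N : ℕ+} (x₀ : Fin N → E d)
    (ε : ℕ → Fin N → E m) (n : ℕ) :
    W1 (empirical (S.particles x₀ ε n)) (S.law μ₀ n) ≤
      ENNReal.ofReal (Real.exp (-ω) + 2 * S.δ * S.σ) ^ n * W1 (empirical x₀) μ₀ +
      ∑ j ∈ Finset.range n, ENNReal.ofReal (Real.exp (-ω) + 2 * S.δ * S.σ) ^ j *
        S.fluctuation x₀ ε (n - 1 - j) := by
  set k := ENNReal.ofReal (Real.exp (-ω) + 2 * S.δ * S.σ) with hk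
  induction n with
  | zero => simp [particles, law]
  | succ n ih =>
    rw [law_succ]
    refine (W1_triangle _ (S.Psi (empirical (S.particles x₀ ε n))) _).trans ?_
    have h := S.W1_Psi_le hD hA hδ (finiteFirstMoment_empirical (S.particles x₀ ε n)) (hμ n)
    calc _ ≤ S.fluctuation x₀ ε n + k * (k ^ n * W1 (empirical x₀) μ₀ +
          ∑ j ∈ Finset.range n, k ^ j * S.fluctuation x₀ ε (n - 1 - j)) := by
          refine add_le_add le_rfl (h.trans ?_)
          gcongr
      _ = _ := by
          rw [Finset.sum_range_succ', mul_add, Finset.mul_sum]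
          have (j : ℕ) : S.fluctuation x₀ ε (n + 1 - 1 - (j + 1)) = S.fluctuation x₀ ε (n - 1 - j) := by
            congr 1; omega
          simp_rw [this]
          simp only [Nat.add_sub_cancel, pow_succ', pow_zero, one_mul, mul_assoc, Nat.sub_zero]
          ring

end Model

/-! ### The particle system as a Markov chain -/

/-- Used with `X` the initial positions, `Y` the past noise and `Z` the current noise: the joint law
is a product of three factors, which can be regrouped. -/
theorem indepFun_prodMk_of_indepFun {Ω α β γ : Type*} [MeasurableSpace Ω] [MeasurableSpace α]
    [MeasurableSpace β] [MeasurableSpace γ] {P : Measure Ω} [IsProbabilityMeasure P]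
    {X : Ω → α} {Y : Ω → β} {Z : Ω → γ} (hX : Measurable X) (hY : Measurable Y)
    (hZ : Measurable Z) (h : IndepFun X (fun w => (Y w, Z w)) P) (hYZ : IndepFun Y Z P) :
    IndepFun (fun w => (X w, Y w)) Z P := by
  have : IsProbabilityMeasure (P.map X) := Measure.isProbabilityMeasure_map hX.aemeasurable
  have : IsProbabilityMeasure (P.map Y) := Measure.isProbabilityMeasure_map hY.aemeasurable
  have : IsProbabilityMeasure (P.map Z) := Measure.isProbabilityMeasure_map hZ.aemeasurable
  have hXY : IndepFun X Y P := h.comp measurable_id measurable_fst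
  rw [indepFun_iff_map_prod_eq_prod_map_map (by fun_prop) (by fun_prop)] at h hYZ hXY ⊢
  rw [hXY]
  rw [hYZ] at h
  have h2 : P.map (fun w => ((X w, Y w), Z w)) =
      (P.map (fun w => (X w, (Y w, Z w)))).map MeasurableEquiv.prodAssoc.symm := by
    rw [Measure.map_map (MeasurableEquiv.measurable _) (by fun_prop)]
    rfl
  rw [h2, h]
  exact ((measurePreserving_prodAssoc _ _ _).symm _).map_eq

theorem measurable_empirical {d : ℕ} {N : ℕ+} :
    Measurable (empirical : (Fin N → E d) → ProbabilityMeasure (E d)) := by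
  refine Measurable.subtype_mk ?_
  refine Measure.measurable_of_measurable_coe _ fun s hs => ?_
  simp only [Measure.smul_apply, Measure.finsetSum_apply, smul_eq_mul]
  refine Measurable.const_mul (Finset.measurable_sum _ fun i _ => ?_) _
  exact (Measure.measurable_coe hs).comp (Measure.measurable_dirac.comp (measurable_pi_apply i))

namespace Model

variable {d m : ℕ} (S : Model d m) {N : ℕ+}

/-- One step of the particle system. -/
def next (x : Fin N → E d) (e : Fin N → E m) : Fin N → E d :=
  fun i => S.step (x i) (empirical x) (e i)

theorem particles_succ (x₀ : Fin N → E d) (ε : ℕ → Fin N → E m) (n : ℕ) :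
    S.particles x₀ ε (n + 1) = S.next (S.particles x₀ ε n) (ε n) := rfl

theorem measurable_next :
    Measurable (fun p : (Fin N → E d) × (Fin N → E m) => S.next p.1 p.2) := by
  refine measurable_pi_lambda _ fun i => ?_
  have h1 : Measurable (fun p : (Fin N → E d) × (Fin N → E m) => p.1 i) :=
    (measurable_pi_apply i).comp measurable_fst
  have h2 : Measurable (fun p : (Fin N → E d) × (Fin N → E m) => p.2 i) :=
    (measurable_pi_apply i).comp measurable_snd
  have h3 : Measurable (fun p : (Fin N → E d) × (Fin N → E m) => empirical p.1) :=
    measurable_empirical.comp measurable_fst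
  exact (S.A.measurable.comp h1).add
    ((S.measurable_f.comp (h1.prodMk (h3.prodMk h2))).const_smul S.δ)

theorem measurable_particles (n : ℕ) :
    Measurable (fun p : (Fin N → E d) × (ℕ → Fin N → E m) => S.particles p.1 p.2 n) := by
  induction n with
  | zero => exact measurable_fst
  | succ n ih =>
    simp only [particles_succ]
    exact S.measurable_next.comp (ih.prodMk ((measurable_pi_apply n).comp measurable_snd))

theorem particles_congr (x₀ : Fin N → E d) {ε ε' : ℕ → Fin N → E m} {n : ℕ}
    (h : ∀ j < n, ε j = ε' j) : S.particles x₀ ε n = S.particles x₀ ε' n := by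
  induction n with
  | zero => rfl
  | succ n ih =>
    rw [particles_succ, particles_succ, ih fun j hj => h j (by omega), h n (by omega)]

/-- The configuration at time `n` is independent of the noise entering the next step, which has
law `θ^{⊗N}`. -/
theorem map_particles_noise {Ω : Type*} [MeasurableSpace Ω] {P : Measure Ω}
    [IsProbabilityMeasure P] {μ₀ : ProbabilityMeasure (E d)} {X₀ : Ω → Fin N → E d}
    {ξ : Ω → ℕ → Fin N → E m} (h : IsInput P μ₀ S.θ X₀ ξ) (n : ℕ) :
    P.map (fun w => (S.particles (X₀ w) (ξ w) n, ξ w n)) =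
      (P.map (fun w => S.particles (X₀ w) (ξ w) n)).prod
        (Measure.pi fun _ : Fin N => (S.θ : Measure (E m))) := by
  classical
  have hX := h.measurable_init
  have hξ := h.measurable_noise
  have hξc : ∀ p : ℕ × Fin N, Measurable (fun w => ξ w p.1 p.2) := fun p =>
    (measurable_pi_apply p.2).comp ((measurable_pi_apply p.1).comp hξ)
  set A : Finset (ℕ × Fin N) := Finset.range n ×ˢ Finset.univ with hA
  set B : Finset (ℕ × Fin N) := {n} ×ˢ Finset.univ with hB
  have hAB : Disjoint A B := by
    rw [Finset.disjoint_left]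
    rintro ⟨j, i⟩ h1 h2
    simp only [hA, hB, Finset.mem_product, Finset.mem_range, Finset.mem_singleton] at h1 h2
    omega
  have hind := h.indep_noise.indepFun_finset A B hAB hξc
  set Y : Ω → A → E m := fun w p => ξ w p.1.1 p.1.2 with hY
  have hYm : Measurable Y := measurable_pi_lambda _ fun p => hξc p.1
  have hZm : Measurable (fun w => ξ w n) := (measurable_pi_apply n).comp hξ
  have hYZ : IndepFun Y (fun w => ξ w n) P :=
    hind.comp (φ := id) (ψ := fun (e : B → E m) (i : Fin N) => e ⟨(n, i), by simp [hB]⟩)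
      measurable_id (measurable_pi_lambda _ fun i => measurable_pi_apply _)
  have hXYZ : IndepFun X₀ (fun w => (Y w, ξ w n)) P := by
    refine h.indep_init_noise.comp (φ := id)
      (ψ := fun (e : ℕ → Fin N → E m) => ((fun p : A => e p.1.1 p.1.2), e n)) measurable_id ?_
    refine Measurable.prodMk (measurable_pi_lambda _ fun p => ?_) (measurable_pi_apply n)
    exact (measurable_pi_apply p.1.2).comp (measurable_pi_apply p.1.1)
  have hI := indepFun_prodMk_of_indepFun hX hYm hZm hXYZ hYZ
  -- The past noise is completed by `0` at later times. By `particles_congr` this does not affect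
  -- the configuration at time `n`, which thereby becomes a measurable function of `X₀` and `Y`
  -- alone.
  set ext : (A → E m) → ℕ → Fin N → E m := fun e j i =>
    if hji : (j, i) ∈ A then e ⟨(j, i), hji⟩ else 0 with hext
  have hextm : Measurable ext := by
    refine measurable_pi_lambda _ fun j => measurable_pi_lambda _ fun i => ?_
    by_cases hji : (j, i) ∈ A
    · simp only [hext, hji, dite_true]; exact measurable_pi_apply _
    · simp only [hext, hji, dite_false]; exact measurable_const
  have hI2 : IndepFun (fun w => S.particles (X₀ w) (ξ w) n) (fun w => ξ w n) P := by
    have hφ : Measurable (fun p : (Fin N → E d) × (A → E m) => S.particles p.1 (ext p.2) n) :=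
      (S.measurable_particles n).comp (measurable_fst.prodMk (hextm.comp measurable_snd))
    have := hI.comp hφ measurable_id
    convert! this using 1
    funext w
    refine S.particles_congr _ fun j hj => ?_
    funext i
    have : (j, i) ∈ A := by simp [hA, hj]
    simp [hext, this, hY]
  have hpm : Measurable (fun w => S.particles (X₀ w) (ξ w) n) :=
    (S.measurable_particles n).comp (hX.prodMk hξ)
  rw [indepFun_iff_map_prod_eq_prod_map_map hpm.aemeasurable hZm.aemeasurable] at hI2
  rw [hI2]
  congr 1
  have hprec : iIndepFun (fun (i : Fin N) w => ξ w n i) P :=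
    h.indep_noise.precomp (g := fun i : Fin N => (n, i)) fun i j hij => (Prod.mk.inj hij).2
  have := (iIndepFun_iff_map_fun_eq_pi_map fun i => (hξc (n, i)).aemeasurable).1 hprec
  rw [this]
  simp only [h.law_noise]

/-- The average of the empirical measure after one step is `Ψ` of the empirical measure. -/
theorem lintegral_empirical_next (x : Fin N → E d) {g : E d → ℝ≥0∞} (hg : Measurable g) :
    ∫⁻ e, ∫⁻ y, g y ∂(empirical (S.next x e) : Measure (E d))
        ∂(Measure.pi fun _ : Fin N => (S.θ : Measure (E m))) =
      ∫⁻ y, g y ∂(S.Psi (empirical x) : Measure (E d)) := by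
  have hs := S.measurable_step (empirical x)
  have hs' : ∀ i, Measurable (fun z => g (S.step (x i) (empirical x) z)) := fun i =>
    hg.comp (hs.comp (measurable_const.prodMk measurable_id))
  have hse : ∀ i, Measurable (fun e : Fin N → E m => g (S.step (x i) (empirical x) (e i))) :=
    fun i => (hs' i).comp (measurable_pi_apply i)
  have hgs : Measurable (fun p : E d × E m => g (S.step p.1 (empirical x) p.2)) := hg.comp hs
  simp only [lintegral_empirical, next]
  rw [lintegral_const_mul _ (Finset.measurable_sum _ fun i _ => hse i),
    lintegral_finsetSum _ fun i _ => hse i]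
  simp only [Psi, ProbabilityMeasure.coe_mk]
  rw [lintegral_map hg hs, lintegral_prod _ hgs.aemeasurable, lintegral_empirical]
  congr 1
  refine Finset.sum_congr rfl fun i _ => ?_
  have := (measurePreserving_eval (fun _ : Fin N => (S.θ : Measure (E m))) i).lintegral_comp (hs' i)
  exact this

theorem measurable_lintegral_empirical {g : E d → ℝ≥0∞} (hg : Measurable g) :
    Measurable (fun x : Fin N → E d => ∫⁻ y, g y ∂(empirical x : Measure (E d))) := by
  simp only [lintegral_empirical]
  exact (Finset.measurable_sum _ fun i _ => hg.comp (measurable_pi_apply i)).const_mul _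

theorem measurable_expMoment_empirical (lam : ℝ) :
    Measurable (fun x : Fin N → E d => expMoment lam (empirical x)) :=
  measurable_lintegral_empirical (by fun_prop)

/-- Conditionally on time `n`, the mean exponential moment at time `n + 1` is that of `Ψ(μ_n^N)`.
The recursion of `expMoment_Psi_le` maps a bound `K` to `ρK + (1 - ρ)K = K`, so `K` is preserved for
all times. -/
theorem lintegral_expMoment_particles_le [NeZero d] {ω : ℝ} (hA : ‖S.A‖ ≤ Real.exp (-ω))
    (hδ : 0 ≤ S.δ) {M : ℝ} (hM : 0 ≤ M)
    (hD : ∀ᵐ z ∂(S.θ : Measure (E m)), S.D z ≤ ENNReal.ofReal M)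
    (hρ : Real.exp (-ω) + 2 * S.δ * M < 1) {α lam : ℝ} (hlam : 0 < lam)
    (hlα : lam * S.δ ≤ α * (1 - (Real.exp (-ω) + 2 * S.δ * M))) {K : ℝ≥0∞}
    (hD₁ : ∫⁻ z, ENNReal.ofReal (Real.exp (α * S.D₁ z)) ∂(S.θ : Measure (E m)) ≤ K)
    {μ₀ : ProbabilityMeasure (E d)} (hμ₀ : expMoment lam μ₀ ≤ K)
    {Ω : Type*} [MeasurableSpace Ω] {P : Measure Ω} [IsProbabilityMeasure P]
    {X₀ : Ω → Fin N → E d} {ξ : Ω → ℕ → Fin N → E m} (h : IsInput P μ₀ S.θ X₀ ξ) (n : ℕ) :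
    ∫⁻ w, expMoment lam (empirical (S.particles (X₀ w) (ξ w) n)) ∂P ≤ K := by
  have hg : Measurable (fun x : E d => ENNReal.ofReal (Real.exp (lam * ‖x‖))) := by fun_prop
  have hpm : ∀ n, Measurable (fun w => S.particles (X₀ w) (ξ w) n) := fun n =>
    (S.measurable_particles n).comp (h.measurable_init.prodMk h.measurable_noise)
  induction n with
  | zero =>
    simp only [expMoment, lintegral_empirical, particles]
    have hm : ∀ i, Measurable (fun w => ENNReal.ofReal (Real.exp (lam * ‖X₀ w i‖))) := fun i =>
      hg.comp ((measurable_pi_apply i).comp h.measurable_init)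
    rw [lintegral_const_mul _ (Finset.measurable_sum _ fun i _ => hm i),
      lintegral_finsetSum _ fun i _ => hm i]
    have : ∀ i, ∫⁻ w, ENNReal.ofReal (Real.exp (lam * ‖X₀ w i‖)) ∂P = expMoment lam μ₀ := by
      intro i
      have hXi : Measurable (fun w => X₀ w i) :=
        (measurable_pi_apply i).comp h.measurable_init
      rw [expMoment, ← h.law_init i, lintegral_map hg hXi]
    simp only [this, Finset.sum_const, Finset.card_univ, Fintype.card_fin, nsmul_eq_mul]
    rw [← mul_assoc, ENNReal.inv_mul_cancel (by simp) (by simp), one_mul]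
    exact hμ₀
  | succ n ih =>
    set ρ := Real.exp (-ω) + 2 * S.δ * M with hρ'
    have hρ0 : 0 ≤ ρ := by positivity
    have hnm : Measurable (fun p : (Fin N → E d) × (Fin N → E m) =>
        expMoment lam (empirical (S.next p.1 p.2))) :=
      (measurable_expMoment_empirical lam).comp S.measurable_next
    have hξn : Measurable (fun w => ξ w n) := (measurable_pi_apply n).comp h.measurable_noise
    have hQ : Measurable (fun w => expMoment lam (empirical (S.particles (X₀ w) (ξ w) n))) :=
      (measurable_expMoment_empirical lam).comp (hpm n)
    have haff : Measurable (fun x : Fin N → E d =>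
        ENNReal.ofReal ρ * expMoment lam (empirical x) + ENNReal.ofReal (1 - ρ) * K) :=
      ((measurable_expMoment_empirical lam).const_mul _).add measurable_const
    calc ∫⁻ w, expMoment lam (empirical (S.particles (X₀ w) (ξ w) (n + 1))) ∂P
        = ∫⁻ p, expMoment lam (empirical (S.next p.1 p.2))
            ∂(P.map (fun w => (S.particles (X₀ w) (ξ w) n, ξ w n))) := by
          rw [lintegral_map hnm ((hpm n).prodMk hξn)]
          rfl
      _ = ∫⁻ x, expMoment lam (S.Psi (empirical x))
            ∂(P.map (fun w => S.particles (X₀ w) (ξ w) n)) := by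
          rw [S.map_particles_noise h n, lintegral_prod _ hnm.aemeasurable]
          refine lintegral_congr fun x => ?_
          exact S.lintegral_empirical_next x hg
      _ ≤ ∫⁻ x, (ENNReal.ofReal ρ * expMoment lam (empirical x) + ENNReal.ofReal (1 - ρ) * K)
            ∂(P.map (fun w => S.particles (X₀ w) (ξ w) n)) := by
          refine lintegral_mono fun x => ?_
          refine (S.expMoment_Psi_le hA hδ hM hD hρ hlam hlα
            (expMoment_empirical_ne_top x)).trans ?_
          gcongr
      _ = ∫⁻ w, (ENNReal.ofReal ρ * expMoment lam (empirical (S.particles (X₀ w) (ξ w) n)) +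
            ENNReal.ofReal (1 - ρ) * K) ∂P := by
          rw [lintegral_map haff (hpm n)]
      _ = ENNReal.ofReal ρ * ∫⁻ w, expMoment lam (empirical (S.particles (X₀ w) (ξ w) n)) ∂P +
            ENNReal.ofReal (1 - ρ) * K := by
          rw [lintegral_add_right _ measurable_const, lintegral_const, measure_univ, mul_one,
            lintegral_const_mul _ hQ]
      _ ≤ ENNReal.ofReal ρ * K + ENNReal.ofReal (1 - ρ) * K := by gcongr
      _ = K := by
          rw [← add_mul, ← ENNReal.ofReal_add hρ0 (by linarith)]
          simp

end Model

/-! ### Quantization -/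

/-- The integer part of a real number, rounded towards zero. -/
def truncInt (u : ℝ) : ℤ := if 0 ≤ u then ⌊u⌋ else ⌈u⌉

theorem abs_sub_truncInt_le (u : ℝ) : |u - truncInt u| ≤ 1 := by
  unfold truncInt
  split_ifs with h <;> rw [abs_le]
  · constructor <;> linarith [Int.floor_le u, Int.lt_floor_add_one u]
  · constructor <;> linarith [Int.le_ceil u, Int.ceil_lt_add_one u]

/-- The reason for rounding towards zero: quantization never increases the norm, so rounded points
remain in the ball of radius `R`. -/
theorem abs_truncInt_le (u : ℝ) : |(truncInt u : ℝ)| ≤ |u| := by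
  unfold truncInt
  split_ifs with h
  · have : (0 : ℝ) ≤ ⌊u⌋ := by exact_mod_cast Int.floor_nonneg.2 h
    rw [abs_of_nonneg this, abs_of_nonneg h]
    exact Int.floor_le u
  · push Not at h
    have : (⌈u⌉ : ℝ) ≤ 0 := by exact_mod_cast Int.ceil_le.2 (by simpa using h.le)
    rw [abs_of_nonpos this, abs_of_neg h]
    linarith [Int.le_ceil u]

theorem measurable_truncInt : Measurable truncInt :=
  Measurable.ite measurableSet_Ici Int.measurable_floor Int.measurable_ceil

/-- The lattice point `h • k` of `ℝᵈ`. -/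
def latticePoint {d : ℕ} (h : ℝ) (k : Fin d → ℤ) : E d := WithLp.toLp 2 fun i => h * (k i : ℝ)

/-- Round the points of the ball of radius `R` towards the origin on the lattice of mesh `h`, and
send all other points to the origin. -/
def quantize {d : ℕ} (R h : ℝ) (y : E d) : E d :=
  if ‖y‖ ≤ R then latticePoint h fun i => truncInt (y i / h) else 0

section Quantize

variable {d : ℕ} {R h : ℝ}

theorem measurable_quantize : Measurable (quantize (d := d) R h) := by
  refine Measurable.ite (measurableSet_le measurable_norm measurable_const) ?_ measurable_const
  refine (PiLp.continuous_toLp 2 _).measurable.comp (measurable_pi_lambda _ fun i => ?_)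
  have h1 : Measurable (fun y : E d => truncInt (y i / h)) :=
    measurable_truncInt.comp (by fun_prop)
  have h2 : Measurable (fun k : ℤ => (k : ℝ)) := measurable_from_top
  exact (h2.comp h1).const_mul h

theorem norm_quantize_le_norm (hh : 0 < h) (y : E d) : ‖quantize R h y‖ ≤ ‖y‖ := by
  unfold quantize
  split_ifs
  · rw [← abs_norm, ← abs_norm y, ← sq_le_sq, EuclideanSpace.norm_sq_eq, EuclideanSpace.norm_sq_eq]
    refine Finset.sum_le_sum fun i _ => ?_
    rw [sq_le_sq, abs_norm, abs_norm, Real.norm_eq_abs, Real.norm_eq_abs]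
    simp only [latticePoint]
    rw [abs_mul, abs_of_pos hh]
    calc h * |(truncInt (y i / h) : ℝ)| ≤ h * |y i / h| :=
          mul_le_mul_of_nonneg_left (abs_truncInt_le _) hh.le
      _ = |y i| := by rw [abs_div, abs_of_pos hh]; field_simp
  · simp

theorem norm_quantize_le (hR : 0 ≤ R) (hh : 0 < h) (y : E d) : ‖quantize R h y‖ ≤ R := by
  by_cases hy : ‖y‖ ≤ R
  · exact (norm_quantize_le_norm hh y).trans hy
  · simp [quantize, hy, hR]

theorem norm_sub_quantize_le (hh : 0 < h) {y : E d} (hy : ‖y‖ ≤ R) :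
    ‖y - quantize R h y‖ ≤ d * h := by
  have h0 : 0 ≤ (d : ℝ) * h := by positivity
  rw [← abs_norm, ← abs_of_nonneg h0, ← sq_le_sq, EuclideanSpace.norm_sq_eq]
  have hi : ∀ i, ‖(y - quantize R h y) i‖ ^ 2 ≤ h ^ 2 := by
    intro i
    rw [sq_le_sq, abs_norm, abs_of_pos hh, Real.norm_eq_abs]
    simp only [quantize, hy, if_true, latticePoint, PiLp.sub_apply]
    have : y i - h * (truncInt (y i / h) : ℝ) = h * (y i / h - truncInt (y i / h)) := by
      field_simp
    rw [this, abs_mul, abs_of_pos hh]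
    exact mul_le_of_le_one_right hh.le (abs_sub_truncInt_le _)
  refine (Finset.sum_le_sum fun i _ => hi i).trans ?_
  simp only [Finset.sum_const, Finset.card_univ, Fintype.card_fin, nsmul_eq_mul]
  -- The sharp constant `√d` is weakened to `d` through `d ≤ d²`.
  rw [mul_pow]
  gcongr
  exact_mod_cast Nat.le_self_pow two_ne_zero d

/-- The lattice points that `quantize R h` can take as values. -/
def quantizeRange (d : ℕ) (R h : ℝ) : Finset (E d) :=
  open Classical in
  (Fintype.piFinset fun _ : Fin d => Finset.Icc (-⌊R / h⌋) ⌊R / h⌋).image (latticePoint h)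

theorem quantize_mem_range (hR : 0 ≤ R) (hh : 0 < h) (y : E d) :
    quantize R h y ∈ quantizeRange d R h := by
  classical
  unfold quantizeRange
  rw [Finset.mem_image]
  by_cases hy : ‖y‖ ≤ R
  · refine ⟨fun i => truncInt (y i / h), ?_, by simp [quantize, hy]⟩
    rw [Fintype.mem_piFinset]
    intro i
    have h1 : |(truncInt (y i / h) : ℝ)| ≤ R / h := by
      refine (abs_truncInt_le _).trans ?_
      rw [abs_div, abs_of_pos hh]
      gcongr
      exact (PiLp.norm_apply_le y i).trans hy
    have h2 : |truncInt (y i / h)| ≤ ⌊R / h⌋ := by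
      rw [Int.le_floor]; exact_mod_cast h1
    exact Finset.mem_Icc.2 (abs_le.1 h2)
  · refine ⟨fun _ => 0, ?_, ?_⟩
    · rw [Fintype.mem_piFinset]
      intro i
      have : 0 ≤ ⌊R / h⌋ := Int.floor_nonneg.2 (by positivity)
      simp [this]
    · simp only [quantize, hy, if_false]
      ext i
      simp [latticePoint]

theorem card_quantizeRange_le (hR : 0 ≤ R) (hh : 0 < h) :
    ((quantizeRange d R h).card : ℝ) ≤ (2 * (R / h) + 1) ^ d := by
  classical
  unfold quantizeRange
  have h0 : 0 ≤ ⌊R / h⌋ := Int.floor_nonneg.2 (by positivity)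
  have h1 : (((Fintype.piFinset fun _ : Fin d => Finset.Icc (-⌊R / h⌋) ⌊R / h⌋).image
      (latticePoint h)).card : ℝ) ≤
      ((Fintype.piFinset fun _ : Fin d => Finset.Icc (-⌊R / h⌋) ⌊R / h⌋).card : ℝ) := by
    exact_mod_cast Finset.card_image_le
  refine h1.trans ?_
  rw [Fintype.card_piFinset]
  simp only [Finset.prod_const, Finset.card_univ, Fintype.card_fin, Int.card_Icc]
  push_cast
  gcongr
  have h2 : ((⌊R / h⌋ + 1 - -⌊R / h⌋).toNat : ℤ) = 2 * ⌊R / h⌋ + 1 := by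
    rw [Int.toNat_of_nonneg (by omega)]; ring
  have h3 : ((⌊R / h⌋ + 1 - -⌊R / h⌋).toNat : ℝ) = 2 * (⌊R / h⌋ : ℝ) + 1 := by exact_mod_cast h2
  rw [h3]
  linarith [Int.floor_le (R / h)]

end Quantize

section FiniteRange

variable {d : ℕ}

theorem map_eq_sum_dirac {α : Type*} [MeasurableSpace α] {μ : Measure α} {q : α → E d}
    (hq : Measurable q) {G : Finset (E d)} (hG : ∀ y, q y ∈ G) :
    μ.map q = ∑ c ∈ G, μ (q ⁻¹' {c}) • Measure.dirac c := by
  classical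
  ext s hs
  rw [Measure.map_apply hq hs, Measure.finsetSum_apply]
  have h1 : q ⁻¹' s = ⋃ c ∈ G.filter (· ∈ s), q ⁻¹' {c} := by
    ext y
    simp [hG y]
  rw [h1, measure_biUnion_finset, Finset.sum_filter]
  · refine Finset.sum_congr rfl fun c _ => ?_
    simp [Measure.dirac_apply' _ hs, Set.indicator_apply]
  · intro c _ c' _ hcc
    exact Disjoint.preimage q (by simpa using hcc)
  · exact fun c _ => hq (measurableSet_singleton c)

theorem measure_preimage_finset {α : Type*} [MeasurableSpace α] (μ : Measure α) {q : α → E d}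
    (hq : Measurable q) (U : Finset (E d)) :
    μ (q ⁻¹' (U : Set (E d))) = ∑ c ∈ U, μ (q ⁻¹' {c}) := by
  have h1 : q ⁻¹' (U : Set (E d)) = ⋃ c ∈ U, q ⁻¹' {c} := by
    ext y
    simp
  rw [h1, measure_biUnion_finset]
  · intro c _ c' _ hcc
    exact Disjoint.preimage q (by simpa using hcc)
  · exact fun c _ => hq (measurableSet_singleton c)

/-- Two laws carried by a finite subset of a ball are close in `W₁` when no event has much larger
probability under the first than under the second. -/
theorem W1_map_map_le {μ ν μ' ν' : ProbabilityMeasure (E d)} {q : E d → E d} (hq : Measurable q)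
    (hμ' : (μ : Measure (E d)).map q = μ') (hν' : (ν : Measure (E d)).map q = ν')
    {G : Finset (E d)} (hG : ∀ y, q y ∈ G) {R t : ℝ≥0∞} (hR : ∀ y, ‖q y‖ₑ ≤ R)
    (ht : ∀ U ⊆ G, (μ : Measure (E d)) (q ⁻¹' (U : Set (E d))) ≤
      (ν : Measure (E d)) (q ⁻¹' (U : Set (E d))) + t) :
    W1 μ' ν' ≤ 2 * R * t := by
  classical
  set a : E d → ℝ≥0∞ := fun c => (μ : Measure (E d)) (q ⁻¹' {c}) with ha
  set b : E d → ℝ≥0∞ := fun c => (ν : Measure (E d)) (q ⁻¹' {c}) with hb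
  have hat : ∀ c, a c ≠ ∞ := fun c => measure_ne_top _ _
  have hbt : ∀ c, b c ≠ ∞ := fun c => measure_ne_top _ _
  have hμs : (μ' : Measure (E d)) = ∑ c ∈ G, a c • Measure.dirac c := by
    rw [← hμ', map_eq_sum_dirac hq hG]
  have hνs : (ν' : Measure (E d)) = ∑ c ∈ G, b c • Measure.dirac c := by
    rw [← hν', map_eq_sum_dirac hq hG]
  have hab : ∀ c, min (a c) (b c) + (a c - b c) = a c := fun c => by
    rw [add_comm]; exact tsub_add_min
  have hba : ∀ c, min (a c) (b c) + (b c - a c) = b c := fun c => by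
    rw [add_comm, min_comm]; exact tsub_add_min
  -- The total excess of `a` over `b` is the discrepancy of the single event `{b < a}`.
  have hpos : ∑ c ∈ G, (a c - b c) ≤ t := by
    set U := G.filter fun c => b c < a c with hU
    have hUG : U ⊆ G := Finset.filter_subset _ _
    have h1 : ∑ c ∈ G, (a c - b c) = ∑ c ∈ U, (a c - b c) := by
      refine (Finset.sum_subset hUG fun c hc hcU => ?_).symm
      have : ¬ b c < a c := fun h => hcU (Finset.mem_filter.2 ⟨hc, h⟩)
      exact tsub_eq_zero_of_le (not_lt.1 this)
    have h2 : ∑ c ∈ U, (a c - b c) + ∑ c ∈ U, b c = ∑ c ∈ U, a c := by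
      rw [← Finset.sum_add_distrib]
      exact Finset.sum_congr rfl fun c hc => tsub_add_cancel_of_le (Finset.mem_filter.1 hc).2.le
    have h3 := ht U hUG
    rw [measure_preimage_finset _ hq, measure_preimage_finset _ hq] at h3
    have hfin : ∑ c ∈ U, b c ≠ ∞ := (ENNReal.sum_lt_top.2 fun c _ => (hbt c).lt_top).ne
    rw [h1]
    refine (ENNReal.add_le_add_iff_right hfin).1 ?_
    rw [h2, add_comm t]
    exact h3
  -- Both laws have mass one, so total deficit equals total excess and the one-sided hypothesis
  -- suffices.
  have htot : ∑ c ∈ G, (b c - a c) = ∑ c ∈ G, (a c - b c) := by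
    have h1 : ∑ c ∈ G, a c = 1 := by
      have h : (μ' : Measure (E d)) Set.univ = 1 := measure_univ
      rw [hμs] at h
      simpa using h
    have h2 : ∑ c ∈ G, b c = 1 := by
      have h : (ν' : Measure (E d)) Set.univ = 1 := measure_univ
      rw [hνs] at h
      simpa using h
    have hfin : ∑ c ∈ G, min (a c) (b c) ≠ ∞ :=
      (ENNReal.sum_lt_top.2 fun c _ => (min_le_left _ _).trans_lt (hat c).lt_top).ne
    rw [← ENNReal.add_right_inj hfin, ← Finset.sum_add_distrib, ← Finset.sum_add_distrib]
    simp only [hab, hba, h1, h2]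
  -- The norm bound `R` is known on the range of `q` only, not on all of `G`; hence weights
  -- vanishing off that range.
  have hbound : ∀ w : E d → ℝ≥0∞, (∀ c, c ∉ Set.range q → w c = 0) →
      ∫⁻ x, ‖x‖ₑ ∂(∑ c ∈ G, w c • Measure.dirac c) ≤ R * ∑ c ∈ G, w c := by
    intro w hw
    rw [lintegral_finsetSum_measure, Finset.mul_sum]
    refine Finset.sum_le_sum fun c _ => ?_
    rw [lintegral_smul_measure, lintegral_dirac, smul_eq_mul, mul_comm]
    by_cases hc : c ∈ Set.range q
    · obtain ⟨y, rfl⟩ := hc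
      gcongr
      exact hR y
    · simp [hw c hc]
  have hnull : ∀ c, c ∉ Set.range q → q ⁻¹' {c} = ∅ := fun c hc => by
    ext y
    simp only [Set.mem_preimage, Set.mem_singleton_iff, Set.mem_empty_iff_false, iff_false]
    exact fun h => hc ⟨y, h⟩
  refine (W1_le_of_common (∑ c ∈ G, min (a c) (b c) • Measure.dirac c)
    (∑ c ∈ G, (a c - b c) • Measure.dirac c) (∑ c ∈ G, (b c - a c) • Measure.dirac c) ?_ ?_).trans ?_
  · rw [hμs, ← Finset.sum_add_distrib]
    refine Finset.sum_congr rfl fun c _ => ?_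
    rw [← add_smul, hab]
  · rw [hνs, ← Finset.sum_add_distrib]
    refine Finset.sum_congr rfl fun c _ => ?_
    rw [← add_smul, hba]
  · refine (add_le_add (hbound _ fun c hc => ?_) (hbound _ fun c hc => ?_)).trans ?_
    · simp [ha, hnull c hc]
    · simp [hb, hnull c hc]
    · rw [htot, ← two_mul, ← mul_assoc]
      gcongr

/-- Inside the ball the rounding error is at most `dh`. Outside, `y` is sent to `0` and, since `1 ≤
λR`, `|y| ≤ R(1 + λ(|y| - R)) ≤ R e^{λ(|y| - R)}`. -/
theorem lintegral_sub_quantize_le {R h lam : ℝ} (hh : 0 < h) (hR : 0 < R)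
    (hlR : 1 ≤ lam * R) (μ : ProbabilityMeasure (E d)) :
    ∫⁻ y, ‖y - quantize R h y‖ₑ ∂(μ : Measure (E d)) ≤
      ENNReal.ofReal (d * h) + ENNReal.ofReal (R * Real.exp (-(lam * R))) * expMoment lam μ := by
  calc ∫⁻ y, ‖y - quantize R h y‖ₑ ∂(μ : Measure (E d))
      ≤ ∫⁻ y, (ENNReal.ofReal (d * h) + ENNReal.ofReal (R * Real.exp (-(lam * R))) *
          ENNReal.ofReal (Real.exp (lam * ‖y‖))) ∂(μ : Measure (E d)) := by
        refine lintegral_mono fun y => ?_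
        by_cases hy : ‖y‖ ≤ R
        · refine le_add_right ?_
          rw [← ofReal_norm]
          exact ENNReal.ofReal_le_ofReal (norm_sub_quantize_le hh hy)
        · refine le_add_left ?_
          rw [← ENNReal.ofReal_mul (by positivity), ← ofReal_norm]
          refine ENNReal.ofReal_le_ofReal ?_
          simp only [quantize, hy, if_false, sub_zero]
          push Not at hy
          rw [mul_assoc, ← Real.exp_add]
          have h1 := Real.add_one_le_exp (-(lam * R) + lam * ‖y‖)
          have h2 : ‖y‖ ≤ R * (-(lam * R) + lam * ‖y‖ + 1) := by nlinarith
          exact h2.trans (by gcongr)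
    _ = _ := by
        rw [lintegral_add_left measurable_const, lintegral_const, measure_univ, mul_one,
          lintegral_const_mul _ (by fun_prop)]
        rfl

theorem W1_le_of_quantize {R h lam : ℝ} (hh : 0 < h) (hR : 0 < R) (hlR : 1 ≤ lam * R) {t : ℝ≥0∞}
    (μ ν : ProbabilityMeasure (E d))
    (ht : ∀ U ⊆ quantizeRange d R h,
      (μ : Measure (E d)) (quantize R h ⁻¹' (U : Set (E d))) ≤
        (ν : Measure (E d)) (quantize R h ⁻¹' (U : Set (E d))) + t) :
    W1 μ ν ≤ 2 * ENNReal.ofReal (d * h) + ENNReal.ofReal (R * Real.exp (-(lam * R))) *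
      (expMoment lam μ + expMoment lam ν) + 2 * ENNReal.ofReal R * t := by
  have hq := measurable_quantize (d := d) (R := R) (h := h)
  set μ' : ProbabilityMeasure (E d) := ⟨(μ : Measure (E d)).map (quantize R h),
    Measure.isProbabilityMeasure_map hq.aemeasurable⟩
  set ν' : ProbabilityMeasure (E d) := ⟨(ν : Measure (E d)).map (quantize R h),
    Measure.isProbabilityMeasure_map hq.aemeasurable⟩
  have h1 : W1 μ μ' ≤ _ := (W1_map_le hq rfl).trans (lintegral_sub_quantize_le hh hR hlR μ)
  have h2 : W1 ν ν' ≤ _ := (W1_map_le hq rfl).trans (lintegral_sub_quantize_le hh hR hlR ν)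
  have h3 : W1 μ' ν' ≤ _ := W1_map_map_le hq rfl rfl (quantize_mem_range hR.le hh)
    (R := ENNReal.ofReal R) (fun y => by
      rw [← ofReal_norm]; exact ENNReal.ofReal_le_ofReal (norm_quantize_le hR.le hh y)) ht
  calc W1 μ ν ≤ W1 μ μ' + (W1 μ' ν' + W1 ν' ν) :=
        (W1_triangle μ μ' ν).trans (add_le_add le_rfl (W1_triangle μ' ν' ν))
    _ = W1 μ μ' + (W1 μ' ν' + W1 ν ν') := by rw [W1_comm ν' ν]
    _ ≤ _ := add_le_add h1 (add_le_add h3 h2)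
    _ = _ := by ring

end FiniteRange

/-! ### Concentration of one step -/

namespace Model

variable {d m : ℕ} (S : Model d m) {N : ℕ+}

theorem measure_empirical_eq (x : Fin N → E d) {B : Set (E d)} (hB : MeasurableSet B) :
    (empirical x : Measure (E d)) B =
      ENNReal.ofReal ((N : ℝ)⁻¹ * ∑ i, B.indicator (fun _ => (1 : ℝ)) (x i)) := by
  have hN : (0 : ℝ) < (N : ℕ) := by exact_mod_cast N.pos
  rw [← lintegral_indicator_one hB, lintegral_empirical, ENNReal.ofReal_mul (by positivity),
    ENNReal.ofReal_inv_of_pos hN, ENNReal.ofReal_natCast,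
    ENNReal.ofReal_sum_of_nonneg fun i _ => Set.indicator_nonneg (fun _ _ => zero_le_one) _]
  congr 1
  refine Finset.sum_congr rfl fun i _ => ?_
  by_cases h : x i ∈ B <;> simp [h]

theorem measurable_empirical_next_apply {B : Set (E d)} (hB : MeasurableSet B) :
    Measurable (fun p : (Fin N → E d) × (Fin N → E m) =>
      (empirical (S.next p.1 p.2) : Measure (E d)) B) := by
  have h : Measurable (fun x : Fin N → E d => (empirical x : Measure (E d)) B) :=
    (Measure.measurable_coe hB).comp (measurable_subtype_coe.comp measurable_empirical)
  exact h.comp S.measurable_next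

theorem lintegral_empirical_next_apply (x : Fin N → E d) {B : Set (E d)} (hB : MeasurableSet B) :
    ∫⁻ e, (empirical (S.next x e) : Measure (E d)) B
        ∂(Measure.pi fun _ : Fin N => (S.θ : Measure (E m))) =
      (S.Psi (empirical x) : Measure (E d)) B := by
  have := S.lintegral_empirical_next x (g := B.indicator 1) (measurable_one.indicator hB)
  simpa only [lintegral_indicator_one hB] using this

/-- Measurability in `x` comes from writing the value as an average over the noise of a jointly
measurable function. -/
theorem measurable_Psi_empirical_apply {B : Set (E d)} (hB : MeasurableSet B) :
    Measurable (fun x : Fin N → E d => (S.Psi (empirical x) : Measure (E d)) B) := by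
  simp only [← S.lintegral_empirical_next_apply _ hB]
  exact (S.measurable_empirical_next_apply hB).lintegral_prod_right'

/-- Hoeffding's inequality for the number of particles that jump into `B`. -/
theorem measure_empirical_next_gt_le (x : Fin N → E d) {B : Set (E d)} (hB : MeasurableSet B)
    {t : ℝ} (ht : 0 ≤ t) :
    (Measure.pi fun _ : Fin N => (S.θ : Measure (E m))).real
      {e | (S.Psi (empirical x) : Measure (E d)) B + ENNReal.ofReal t <
        (empirical (S.next x e) : Measure (E d)) B} ≤ Real.exp (-(2 * N * t ^ 2)) := by
  set Q : Measure (Fin N → E m) := Measure.pi fun _ : Fin N => (S.θ : Measure (E m)) with hQ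
  have hN : (0 : ℝ) < (N : ℕ) := by exact_mod_cast N.pos
  set φ : Fin N → E m → ℝ := fun i z =>
    B.indicator (fun _ => (1 : ℝ)) (S.step (x i) (empirical x) z) with hφ
  have hφm : ∀ i, Measurable (φ i) := fun i =>
    (measurable_const.indicator hB).comp
      ((S.measurable_step (empirical x)).comp (measurable_const.prodMk measurable_id))
  set Z : Fin N → (Fin N → E m) → ℝ := fun i e => φ i (e i) with hZ
  have hZm : ∀ i, Measurable (Z i) := fun i => (hφm i).comp (measurable_pi_apply i)
  have hZmem : ∀ i e, Z i e ∈ Set.Icc (0 : ℝ) 1 := fun i e => by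
    simp only [hZ, hφ]
    by_cases h : S.step (x i) (empirical x) (e i) ∈ B <;> simp [h]
  have hZint : ∀ i, Integrable (Z i) Q := fun i =>
    Integrable.of_mem_Icc 0 1 (hZm i).aemeasurable (Filter.Eventually.of_forall (hZmem i))
  -- Indicators are sub-Gaussian with variance proxy `1/4`, for a total of `N/4`; deviation `Nt` of
  -- the sum then gives the exponent `2Nt²`. The summands are independent but not identically
  -- distributed, as each particle has its own starting point.
  have hsub : ∀ i ∈ (Finset.univ : Finset (Fin N)),
      HasSubgaussianMGF (fun e => Z i e - Q[Z i]) ((‖(1 : ℝ) - 0‖₊ / 2) ^ 2) Q := fun i _ =>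
    hasSubgaussianMGF_of_mem_Icc (hZm i).aemeasurable (Filter.Eventually.of_forall (hZmem i))
  have hind : iIndepFun (fun i e => Z i e - Q[Z i]) Q :=
    iIndepFun_pi (X := fun i z => φ i z - Q[Z i]) fun i =>
      ((hφm i).sub_const _).aemeasurable
  have hH := HasSubgaussianMGF.measure_sum_ge_le_of_iIndepFun hind hsub
    (ε := N * t) (by positivity)
  have hemp : ∀ e, (empirical (S.next x e) : Measure (E d)) B =
      ENNReal.ofReal ((N : ℝ)⁻¹ * ∑ i, Z i e) := fun e => measure_empirical_eq _ hB
  have hsum0 : ∀ e, 0 ≤ (N : ℝ)⁻¹ * ∑ i, Z i e := fun e =>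
    mul_nonneg (by positivity) (Finset.sum_nonneg fun i _ => (hZmem i e).1)
  have hmean : (S.Psi (empirical x) : Measure (E d)) B =
      ENNReal.ofReal ((N : ℝ)⁻¹ * ∑ i, Q[Z i]) := by
    rw [← S.lintegral_empirical_next_apply x hB]
    simp only [hemp]
    rw [← ofReal_integral_eq_lintegral_ofReal
      ((integrable_finsetSum _ fun i _ => hZint i).const_mul _)
      (Filter.Eventually.of_forall hsum0), integral_const_mul,
      integral_finsetSum _ fun i _ => hZint i]
  refine (measureReal_mono ?_ (measure_ne_top _ _)).trans (hH.trans ?_)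
  · intro e he
    simp only [Set.mem_ofPred_eq] at he ⊢
    have hm0 : 0 ≤ (N : ℝ)⁻¹ * ∑ i, Q[Z i] :=
      mul_nonneg (by positivity) (Finset.sum_nonneg fun i _ =>
        integral_nonneg fun e => (hZmem i e).1)
    rw [hmean, hemp, ← ENNReal.ofReal_add hm0 ht, ENNReal.ofReal_lt_ofReal_iff_of_nonneg
      (by positivity)] at he
    rw [Finset.sum_sub_distrib]
    have h2 := mul_lt_mul_of_pos_left he hN
    rw [mul_add, mul_inv_cancel_left₀ hN.ne', mul_inv_cancel_left₀ hN.ne'] at h2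
    linarith
  · refine Real.exp_le_exp.2 (le_of_eq ?_)
    simp
    field_simp

/-- The event that, in one step, some union of cells receives too many particles. -/
def badEvent (N : ℕ+) (R h t : ℝ) : Set ((Fin N → E d) × (Fin N → E m)) :=
  ⋃ U ∈ (quantizeRange d R h).powerset,
    {p | (S.Psi (empirical p.1) : Measure (E d)) (quantize R h ⁻¹' (U : Set (E d))) +
      ENNReal.ofReal t <
      (empirical (S.next p.1 p.2) : Measure (E d)) (quantize R h ⁻¹' (U : Set (E d)))}

theorem measurableSet_cell {R h : ℝ} (U : Finset (E d)) :
    MeasurableSet (quantize R h ⁻¹' (U : Set (E d))) :=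
  measurable_quantize U.measurableSet

theorem measurableSet_badEvent (R h t : ℝ) : MeasurableSet (S.badEvent N R h t) := by
  refine Finset.measurableSet_biUnion _ fun U _ => ?_
  refine measurableSet_lt ?_ (S.measurable_empirical_next_apply (measurableSet_cell U))
  exact ((S.measurable_Psi_empirical_apply (measurableSet_cell U)).comp measurable_fst).add_const _

theorem measure_badEvent_section_le (x : Fin N → E d) {R h t : ℝ} (ht : 0 ≤ t) :
    (Measure.pi fun _ : Fin N => (S.θ : Measure (E m))) (Prod.mk x ⁻¹' S.badEvent N R h t) ≤
      ENNReal.ofReal (2 ^ (quantizeRange d R h).card * Real.exp (-(2 * N * t ^ 2))) := by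
  have hpre : Prod.mk x ⁻¹' S.badEvent N R h t = ⋃ U ∈ (quantizeRange d R h).powerset,
      {e | (S.Psi (empirical x) : Measure (E d)) (quantize R h ⁻¹' (U : Set (E d))) +
      ENNReal.ofReal t <
      (empirical (S.next x e) : Measure (E d)) (quantize R h ⁻¹' (U : Set (E d)))} := by
    ext e
    simp [badEvent]
  rw [hpre]
  refine (measure_biUnion_finset_le _ _).trans ?_
  have hle : ∀ U ∈ (quantizeRange d R h).powerset,
      (Measure.pi fun _ : Fin N => (S.θ : Measure (E m)))
      {e | (S.Psi (empirical x) : Measure (E d)) (quantize R h ⁻¹' (U : Set (E d))) +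
      ENNReal.ofReal t <
      (empirical (S.next x e) : Measure (E d)) (quantize R h ⁻¹' (U : Set (E d)))} ≤
      ENNReal.ofReal (Real.exp (-(2 * N * t ^ 2))) := fun U _ => by
    rw [← ofReal_measureReal]
    exact ENNReal.ofReal_le_ofReal
      (S.measure_empirical_next_gt_le x (measurableSet_cell U) ht)
  refine (Finset.sum_le_sum hle).trans (le_of_eq ?_)
  rw [Finset.sum_const, Finset.card_powerset, nsmul_eq_mul, ENNReal.ofReal_mul (by positivity),
    ENNReal.ofReal_pow (by norm_num)]
  simp

/-- The bound on sections does not depend on the configuration, so it integrates against the law of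
the particles whatever that is. -/
theorem measure_particles_badEvent_le {Ω : Type*} [MeasurableSpace Ω] {P : Measure Ω}
    [IsProbabilityMeasure P] {μ₀ : ProbabilityMeasure (E d)} {X₀ : Ω → Fin N → E d}
    {ξ : Ω → ℕ → Fin N → E m} (h : IsInput P μ₀ S.θ X₀ ξ) (n : ℕ) {R η t : ℝ} (ht : 0 ≤ t) :
    P {w | (S.particles (X₀ w) (ξ w) n, ξ w n) ∈ S.badEvent N R η t} ≤
      ENNReal.ofReal (2 ^ (quantizeRange d R η).card * Real.exp (-(2 * N * t ^ 2))) := by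
  have hpm : Measurable (fun w => S.particles (X₀ w) (ξ w) n) :=
    (S.measurable_particles n).comp (h.measurable_init.prodMk h.measurable_noise)
  have hξn : Measurable (fun w => ξ w n) := (measurable_pi_apply n).comp h.measurable_noise
  have hb := S.measurableSet_badEvent (N := N) R η t
  have : IsProbabilityMeasure (P.map fun w => S.particles (X₀ w) (ξ w) n) :=
    Measure.isProbabilityMeasure_map hpm.aemeasurable
  have h1 : P {w | (S.particles (X₀ w) (ξ w) n, ξ w n) ∈ S.badEvent N R η t} =
      (P.map (fun w => (S.particles (X₀ w) (ξ w) n, ξ w n))) (S.badEvent N R η t) := by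
    rw [Measure.map_apply (hpm.prodMk hξn) hb]; rfl
  rw [h1, S.map_particles_noise h n, Measure.prod_apply hb]
  refine (lintegral_mono fun x => S.measure_badEvent_section_le x ht).trans ?_
  simp

end Model

/-- Entropy against concentration. With `s = n(ε/(8R))²`, `hb₁` bounds the number `c` of cells by
`(2u)^d`, `hb₂` gives `(2u)^d ≤ s`, and `hRn` says `R ≤ s`. Hence the exponent `c - 2s` is at most
`-R`. -/
theorem two_pow_card_quantizeRange_mul_exp_le {d : ℕ} (hd : 0 < d) {b u ε R n : ℝ}
    (hb₁ : 16 * d * b ≤ 1) (hb₂ : 64 * b ^ 2 * 2 ^ d ≤ 1) (hu : 1 ≤ u) (hn : u ^ (d + 2) = n)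
    (hε : 0 < ε) (hR : 0 < R) (hRu : R ≤ b * ε * u) (hRn : 64 * R ^ 3 ≤ n * ε ^ 2) :
    2 ^ (quantizeRange d R (ε / (8 * d))).card * Real.exp (-(2 * n * (ε / (8 * R)) ^ 2)) ≤
      Real.exp (-R) := by
  have hd' : (0 : ℝ) < d := by exact_mod_cast hd
  have hu0 : 0 < u := by linarith
  set c := (quantizeRange d R (ε / (8 * d))).card with hc
  have h1 : (c : ℝ) ≤ (2 * u) ^ d := by
    refine (card_quantizeRange_le hR.le (by positivity)).trans ?_
    gcongr
    have e : 2 * (R / (ε / (8 * d))) = 16 * d * R / ε := by field_simp; ring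
    have : 16 * d * R / ε ≤ u := by
      rw [div_le_iff₀ hε]
      calc 16 * d * R ≤ 16 * d * (b * ε * u) := by gcongr
        _ = (16 * d * b) * (u * ε) := by ring
        _ ≤ 1 * (u * ε) := by gcongr
        _ = u * ε := one_mul _
    rw [e]
    linarith
  set s := n * (ε / (8 * R)) ^ 2 with hs
  have hs' : s = n * ε ^ 2 / (64 * R ^ 2) := by rw [hs]; field_simp; ring
  have h2 : (2 * u) ^ d ≤ s := by
    rw [hs', le_div_iff₀ (by positivity), ← hn]
    calc (2 * u) ^ d * (64 * R ^ 2) ≤ (2 * u) ^ d * (64 * (b * ε * u) ^ 2) := by gcongr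
      _ = (64 * b ^ 2 * 2 ^ d) * (u ^ (d + 2) * ε ^ 2) := by rw [mul_pow]; ring
      _ ≤ 1 * (u ^ (d + 2) * ε ^ 2) := by gcongr
      _ = _ := one_mul _
  have h3 : R ≤ s := by
    rw [hs', le_div_iff₀ (by positivity)]
    linarith
  have h4 : (2 : ℝ) ^ c ≤ Real.exp c := by
    have : (2 : ℝ) ≤ Real.exp 1 := by linarith [Real.add_one_le_exp (1 : ℝ)]
    calc (2 : ℝ) ^ c ≤ Real.exp 1 ^ c := by gcongr
      _ = Real.exp c := by rw [← Real.exp_nat_mul, mul_one]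
  calc (2 : ℝ) ^ c * Real.exp (-(2 * n * (ε / (8 * R)) ^ 2))
      ≤ Real.exp c * Real.exp (-(2 * n * (ε / (8 * R)) ^ 2)) := by gcongr
    _ = Real.exp (c - 2 * s) := by rw [← Real.exp_add]; congr 1; rw [hs]; ring
    _ ≤ Real.exp (-R) := Real.exp_le_exp.2 (by linarith)

namespace Model

variable {d m : ℕ} (S : Model d m) {N : ℕ+}

theorem measure_expMoment_particles_ge_le [NeZero d] {ω : ℝ} (hA : ‖S.A‖ ≤ Real.exp (-ω))
    (hδ : 0 ≤ S.δ) {M : ℝ} (hM : 0 ≤ M)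
    (hD : ∀ᵐ z ∂(S.θ : Measure (E m)), S.D z ≤ ENNReal.ofReal M)
    (hρ : Real.exp (-ω) + 2 * S.δ * M < 1) {α lam : ℝ} (hlam : 0 < lam)
    (hlα : lam * S.δ ≤ α * (1 - (Real.exp (-ω) + 2 * S.δ * M))) {K : ℝ}
    (hD₁ : ∫⁻ z, ENNReal.ofReal (Real.exp (α * S.D₁ z)) ∂(S.θ : Measure (E m)) ≤
      ENNReal.ofReal K)
    {μ₀ : ProbabilityMeasure (E d)} (hμ₀ : expMoment lam μ₀ ≤ ENNReal.ofReal K)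
    {Ω : Type*} [MeasurableSpace Ω] {P : Measure Ω} [IsProbabilityMeasure P]
    {X₀ : Ω → Fin N → E d} {ξ : Ω → ℕ → Fin N → E m} (h : IsInput P μ₀ S.θ X₀ ξ) (n : ℕ)
    (r : ℝ) :
    P {w | ENNReal.ofReal (Real.exp r) ≤ expMoment lam (empirical (S.particles (X₀ w) (ξ w) n))} ≤
      ENNReal.ofReal (K * Real.exp (-r)) := by
  have hm : Measurable (fun w => expMoment lam (empirical (S.particles (X₀ w) (ξ w) n))) :=
    (measurable_expMoment_empirical lam).comp
      ((S.measurable_particles n).comp (h.measurable_init.prodMk h.measurable_noise))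
  have h1 := mul_meas_ge_le_lintegral (μ := P) hm (ENNReal.ofReal (Real.exp r))
  have h2 := h1.trans (S.lintegral_expMoment_particles_le hA hδ hM hD hρ hlam hlα hD₁ hμ₀ h n)
  have h3 : ENNReal.ofReal (Real.exp (-r)) * ENNReal.ofReal (Real.exp r) = 1 := by
    rw [← ENNReal.ofReal_mul (Real.exp_pos _).le, ← Real.exp_add]; simp
  calc _ = ENNReal.ofReal (Real.exp (-r)) * (ENNReal.ofReal (Real.exp r) * P {w |
        ENNReal.ofReal (Real.exp r) ≤
          expMoment lam (empirical (S.particles (X₀ w) (ξ w) n))}) := by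
        rw [← mul_assoc, h3, one_mul]
    _ ≤ ENNReal.ofReal (Real.exp (-r)) * ENNReal.ofReal K := by gcongr
    _ = _ := by rw [← ENNReal.ofReal_mul (Real.exp_pos _).le, mul_comm]

/-- Concentration of the empirical measure around its conditional mean, in one step. -/
theorem measure_fluctuation_gt_le [NeZero d] {ω : ℝ} (hA : ‖S.A‖ ≤ Real.exp (-ω))
    (hδ : 0 ≤ S.δ) {M : ℝ} (hM : 0 ≤ M)
    (hD : ∀ᵐ z ∂(S.θ : Measure (E m)), S.D z ≤ ENNReal.ofReal M)
    (hρ : Real.exp (-ω) + 2 * S.δ * M < 1) {α lam : ℝ} (hlam : 0 < lam)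
    (hlα : lam * S.δ ≤ α * (1 - (Real.exp (-ω) + 2 * S.δ * M))) {K : ℝ} (hK : 0 ≤ K)
    (hD₁ : ∫⁻ z, ENNReal.ofReal (Real.exp (α * S.D₁ z)) ∂(S.θ : Measure (E m)) ≤
      ENNReal.ofReal K)
    {μ₀ : ProbabilityMeasure (E d)} (hμ₀ : expMoment lam μ₀ ≤ ENNReal.ofReal K)
    {Ω : Type*} [MeasurableSpace Ω] {P : Measure Ω} [IsProbabilityMeasure P]
    {X₀ : Ω → Fin N → E d} {ξ : Ω → ℕ → Fin N → E m} (h : IsInput P μ₀ S.θ X₀ ξ) (n : ℕ)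
    {b u ε R : ℝ} (hb₁ : 16 * d * b ≤ 1) (hb₂ : 64 * b ^ 2 * 2 ^ d ≤ 1) (hu : 1 ≤ u)
    (hN : u ^ (d + 2) = (N : ℕ)) (hε : 0 < ε) (hR : 0 < R) (hRu : R ≤ b * ε * u)
    (hRn : 64 * R ^ 3 ≤ (N : ℕ) * ε ^ 2) (hlR : 1 ≤ lam * R)
    (htail : (2 + K) * (R * Real.exp (-(lam * R / 2))) ≤ ε / 4) :
    P.real {w | ENNReal.ofReal ε < S.fluctuation (X₀ w) (ξ w) n} ≤
      2 * K * Real.exp (-(lam * R / 2)) + Real.exp (-R) := by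
  have hd : 0 < d := Nat.pos_of_neZero d
  have hd' : (0 : ℝ) < d := by exact_mod_cast hd
  -- The mesh error `2dη` and the cell error `2Rt` are each exactly `ε/4`; `htail` reserves another
  -- `ε/4` for the mass outside the ball.
  set η := ε / (8 * d) with hη
  set t := ε / (8 * R) with ht
  have hη0 : 0 < η := by positivity
  have ht0 : 0 < t := by positivity
  -- Half of the decay `e^{-λR}` pays for exponential moments as large as `e^r`; the other half
  -- remains, both in the tail error and in Markov's inequality.
  set r := lam * R / 2 with hr
  set X : Ω → ℕ → Fin N → E d := fun w n => S.particles (X₀ w) (ξ w) n with hX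
  set B₁ := {w | ENNReal.ofReal (Real.exp r) ≤ expMoment lam (empirical (X w n))} with hB₁
  set B₂ := {w | ENNReal.ofReal (Real.exp r) ≤ expMoment lam (empirical (X w (n + 1)))} with hB₂
  set B₃ := {w | (X w n, ξ w n) ∈ S.badEvent N R η t} with hB₃
  have hρ0 : 0 ≤ Real.exp (-ω) + 2 * S.δ * M := by positivity
  have hsubset : {w | ENNReal.ofReal ε < S.fluctuation (X₀ w) (ξ w) n} ⊆ B₁ ∪ B₂ ∪ B₃ := by
    intro w hw
    by_contra hcon
    simp only [Set.mem_union, not_or] at hcon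
    obtain ⟨⟨h₁, h₂⟩, h₃⟩ := hcon
    have h₁' : expMoment lam (empirical (X w n)) ≤ ENNReal.ofReal (Real.exp r) :=
      (not_le.1 h₁).le
    have h₂' : expMoment lam (empirical (X w (n + 1))) ≤ ENNReal.ofReal (Real.exp r) :=
      (not_le.1 h₂).le
    -- The moment of `Ψ(μ_n^N)` is bounded pathwise by that of `μ_n^N`, so it needs no further
    -- exceptional event.
    have hPsi : expMoment lam (S.Psi (empirical (X w n))) ≤ ENNReal.ofReal (Real.exp r + K) := by
      refine (S.expMoment_Psi_le hA hδ hM hD hρ hlam hlα (expMoment_empirical_ne_top _)).trans ?_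
      rw [ENNReal.ofReal_add (Real.exp_pos _).le hK]
      refine add_le_add ?_ ?_
      · calc _ ≤ 1 * ENNReal.ofReal (Real.exp r) := by
              gcongr
              exact ENNReal.ofReal_le_one.2 hρ.le
          _ = _ := one_mul _
      · calc _ ≤ 1 * ENNReal.ofReal K := by
              gcongr
              exact ENNReal.ofReal_le_one.2 (by linarith)
          _ = _ := one_mul _
    have hcells : ∀ U ⊆ quantizeRange d R η,
        (empirical (X w (n + 1)) : Measure (E d)) (quantize R η ⁻¹' (U : Set (E d))) ≤
        (S.Psi (empirical (X w n)) : Measure (E d)) (quantize R η ⁻¹' (U : Set (E d))) +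
          ENNReal.ofReal t := by
      intro U hU
      by_contra hlt
      refine h₃ ?_
      simp only [hB₃, badEvent, Set.mem_ofPred_eq, Set.mem_iUnion]
      exact ⟨U, Finset.mem_powerset.2 hU, not_le.1 hlt⟩
    have hW := W1_le_of_quantize hη0 hR hlR _ _ hcells
    refine absurd hw (not_lt.2 (hW.trans ?_))
    have e1 : 2 * ENNReal.ofReal (d * η) = ENNReal.ofReal (ε / 4) := by
      rw [← ENNReal.ofReal_ofNat 2, ← ENNReal.ofReal_mul (by norm_num)]
      congr 1
      rw [hη]; field_simp; norm_num
    have e2 : 2 * ENNReal.ofReal R * ENNReal.ofReal t = ENNReal.ofReal (ε / 4) := by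
      rw [← ENNReal.ofReal_ofNat 2, ← ENNReal.ofReal_mul (by norm_num),
        ← ENNReal.ofReal_mul (by positivity)]
      congr 1
      rw [ht]; field_simp; norm_num
    have e3 : ENNReal.ofReal (R * Real.exp (-(lam * R))) *
        (expMoment lam (empirical (X w (n + 1))) + expMoment lam (S.Psi (empirical (X w n)))) ≤
        ENNReal.ofReal (ε / 4) := by
      calc _ ≤ ENNReal.ofReal (R * Real.exp (-(lam * R))) *
            (ENNReal.ofReal (Real.exp r) + ENNReal.ofReal (Real.exp r + K)) := by gcongr
        _ = ENNReal.ofReal (R * Real.exp (-(lam * R)) * (Real.exp r + (Real.exp r + K))) := by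
            rw [← ENNReal.ofReal_add (by positivity) (by positivity),
              ← ENNReal.ofReal_mul (by positivity)]
        _ ≤ ENNReal.ofReal (ε / 4) := by
            refine ENNReal.ofReal_le_ofReal (le_trans ?_ htail)
            have hr0 : 1 ≤ Real.exp r := Real.one_le_exp (by rw [hr]; positivity)
            have e4 : Real.exp (-r) = Real.exp (-(lam * R)) * Real.exp r := by
              rw [← Real.exp_add]; congr 1; rw [hr]; ring
            rw [e4]
            have : Real.exp r + (Real.exp r + K) ≤ (2 + K) * Real.exp r := by nlinarith
            calc R * Real.exp (-(lam * R)) * (Real.exp r + (Real.exp r + K))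
                ≤ R * Real.exp (-(lam * R)) * ((2 + K) * Real.exp r) := by gcongr
              _ = _ := by ring
    rw [e1, e2]
    calc _ ≤ ENNReal.ofReal (ε / 4) + ENNReal.ofReal (ε / 4) + ENNReal.ofReal (ε / 4) := by gcongr
      _ = ENNReal.ofReal (ε / 4 + ε / 4 + ε / 4) := by
          rw [ENNReal.ofReal_add (by positivity) (by positivity),
            ENNReal.ofReal_add (by positivity) (by positivity)]
      _ ≤ ENNReal.ofReal ε := ENNReal.ofReal_le_ofReal (by linarith)
  have hp₁ : P B₁ ≤ _ :=
    S.measure_expMoment_particles_ge_le hA hδ hM hD hρ hlam hlα hD₁ hμ₀ h n r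
  have hp₂ : P B₂ ≤ _ :=
    S.measure_expMoment_particles_ge_le hA hδ hM hD hρ hlam hlα hD₁ hμ₀ h (n + 1) r
  have hp₃ : P B₃ ≤ ENNReal.ofReal (Real.exp (-R)) :=
    (S.measure_particles_badEvent_le h n ht0.le).trans (ENNReal.ofReal_le_ofReal
      (two_pow_card_quantizeRange_mul_exp_le hd hb₁ hb₂ hu hN hε hR hRu hRn))
  refine ENNReal.toReal_le_of_le_ofReal (by positivity) ?_
  calc P {w | ENNReal.ofReal ε < S.fluctuation (X₀ w) (ξ w) n}
      ≤ P B₁ + P B₂ + P B₃ := by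
        refine (measure_mono hsubset).trans ((measure_union_le _ _).trans ?_)
        gcongr
        exact measure_union_le _ _
    _ ≤ ENNReal.ofReal (K * Real.exp (-r)) + ENNReal.ofReal (K * Real.exp (-r)) +
          ENNReal.ofReal (Real.exp (-R)) := by gcongr
    _ = _ := by
        rw [← ENNReal.ofReal_add (by positivity) (by positivity),
          ← ENNReal.ofReal_add (by positivity) (by positivity)]
        congr 1
        ring

end Model

/-! ### Concentration uniformly in time -/

/-- Bernoulli's inequality `g^j ≥ 1 + j(g - 1)` dominates the sum by a geometric series of ratio
`e^{-T(g-1)} ≤ 1/2`. This makes the final bound uniform in `n`. -/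
theorem sum_exp_neg_mul_pow_le {T g : ℝ} (hg : 1 < g) (hT : 1 ≤ T * (g - 1)) (n : ℕ) :
    ∑ j ∈ Finset.range n, Real.exp (-(T * g ^ j)) ≤ 2 * Real.exp (-T) := by
  have hT0 : 0 < T := by
    by_contra h
    nlinarith
  set q := Real.exp (-(T * (g - 1))) with hq
  have hq0 : 0 < q := Real.exp_pos _
  have hq1 : q ≤ 1 / 2 := by
    have h1 : q ≤ Real.exp (-1) := Real.exp_le_exp.2 (by linarith)
    have h2 : (2 : ℝ) ≤ Real.exp 1 := by linarith [Real.add_one_le_exp (1 : ℝ)]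
    rw [Real.exp_neg] at h1
    refine h1.trans ?_
    rw [one_div]
    exact inv_anti₀ (by norm_num) h2
  have hterm : ∀ j, Real.exp (-(T * g ^ j)) ≤ Real.exp (-T) * q ^ j := by
    intro j
    rw [hq, ← Real.exp_nat_mul, ← Real.exp_add]
    refine Real.exp_le_exp.2 ?_
    have hb := one_add_mul_le_pow (a := g - 1) (by linarith) j
    rw [add_sub_cancel] at hb
    nlinarith
  calc ∑ j ∈ Finset.range n, Real.exp (-(T * g ^ j))
      ≤ ∑ j ∈ Finset.range n, Real.exp (-T) * q ^ j := Finset.sum_le_sum fun j _ => hterm j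
    _ = Real.exp (-T) * ∑ j ∈ Finset.range n, q ^ j := by rw [Finset.mul_sum]
    _ ≤ Real.exp (-T) * 2 := by
        gcongr
        have h1 : (∑ j ∈ Finset.range n, q ^ j) * (1 - q) = 1 - q ^ n := geom_sum_mul_neg q n
        have h2 : 0 ≤ ∑ j ∈ Finset.range n, q ^ j := Finset.sum_nonneg fun j _ => by positivity
        have h3 : 0 < q ^ n := by positivity
        nlinarith
    _ = _ := mul_comm _ _

/-- Split `e^{-λR/2}` into two equal factors: one absorbs `R`, the other produces `ε` and a small
constant. The latter holds because `τH ≥ log(1/ε) + τL/2`, which for `ε ≤ 1` follows by averaging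
the two lower bounds on `H`, and for `ε ≥ 1` from `L ≤ H` alone. -/
theorem mul_exp_neg_le {K lam R τ H L c ε : ℝ} (hK : 0 ≤ K) (hlam : 0 < lam)
    (hτ : 0 < τ) (hτR : τ * H ≤ lam * R / 4) (hc : 0 < c) (hε : 0 < ε) (hLH : L ≤ H)
    (hLε : L * Real.log (1 / ε) ≤ H) (hL₁ : 1 ≤ τ * L / 2)
    (hL₂ : (2 + K) * 16 / (lam * c) ≤ τ * L / 2) :
    (2 + K) * (R * Real.exp (-(lam * R / 2))) ≤ c * ε / 4 := by
  have h1 : R * Real.exp (-(lam * R / 4)) ≤ 4 / lam := by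
    have h := Real.add_one_le_exp (lam * R / 4)
    rw [Real.exp_neg, ← div_eq_mul_inv, div_le_div_iff₀ (Real.exp_pos _) hlam]
    linarith
  have h2 : Real.exp (-(lam * R / 4)) ≤ ε * Real.exp (-(τ * L / 2)) := by
    have : ε * Real.exp (-(τ * L / 2)) = Real.exp (Real.log ε + -(τ * L / 2)) := by
      rw [Real.exp_add, Real.exp_log hε]
    rw [this]
    refine Real.exp_le_exp.2 ?_
    rw [one_div, Real.log_inv] at hLε
    have h3 := mul_le_mul_of_nonneg_left hLH hτ.le
    have h4 := mul_le_mul_of_nonneg_left hLε hτ.le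
    rcases le_total 0 (Real.log ε) with h | h
    · nlinarith
    · nlinarith [mul_le_mul_of_nonneg_right hL₁ (neg_nonneg.2 h)]
  have h3 : Real.exp (-(τ * L / 2)) * ((2 + K) * 16) ≤ lam * c := by
    rw [Real.exp_neg, ← div_eq_inv_mul, div_le_iff₀ (Real.exp_pos _)]
    rw [div_le_iff₀ (by positivity)] at hL₂
    have h := Real.add_one_le_exp (τ * L / 2)
    have : τ * L / 2 * (lam * c) ≤ Real.exp (τ * L / 2) * (lam * c) := by
      gcongr; linarith
    linarith
  have e : Real.exp (-(lam * R / 2)) =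
      Real.exp (-(lam * R / 4)) * Real.exp (-(lam * R / 4)) := by
    rw [← Real.exp_add]; congr 1; ring
  calc (2 + K) * (R * Real.exp (-(lam * R / 2)))
      = (2 + K) * ((R * Real.exp (-(lam * R / 4))) * Real.exp (-(lam * R / 4))) := by
        rw [e]; ring
    _ ≤ (2 + K) * ((4 / lam) * (ε * Real.exp (-(τ * L / 2)))) := by gcongr
    _ = (Real.exp (-(τ * L / 2)) * ((2 + K) * 16)) * (ε / (4 * lam)) := by field_simp; ring
    _ ≤ (lam * c) * (ε / (4 * lam)) := by gcongr
    _ = c * ε / 4 := by field_simp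

namespace Model

variable {d m : ℕ} (S : Model d m)

/-- If the initial empirical measure is close to `μ₀` and the empirical measure at time `n` is far
from `μₙ`, then one of the one-step fluctuations is large. -/
theorem exists_fluctuation_gt [NeZero d] {M : ℝ}
    (hD : ∀ᵐ z ∂(S.θ : Measure (E m)), S.D z ≤ ENNReal.ofReal M)
    {ω : ℝ} (hA : ‖S.A‖ ≤ Real.exp (-ω)) (hδ : 0 ≤ S.δ) {μ₀ : ProbabilityMeasure (E d)}
    (hμ : ∀ n, FiniteFirstMoment (S.law μ₀ n)) {γ s : ℝ} (hγ : 0 ≤ γ) (hγ1 : γ < 1) (hs : 0 < s)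
    (hs1 : s < 1) (hsk : s ^ 4 = Real.exp (-ω) + 2 * S.δ * S.σ) {N : ℕ+} {x₀ : Fin N → E d}
    {ξ : ℕ → Fin N → E m} {n : ℕ} {ε : ℝ} (hε : 0 < ε)
    (h₀ : W1 (empirical x₀) μ₀ ≤ ENNReal.ofReal (γ * ((1 - γ) / s ^ 4) ^ n * ε))
    (hn : ENNReal.ofReal ε < W1 (empirical (S.particles x₀ ξ n)) (S.law μ₀ n)) :
    ∃ j ∈ Finset.range n, ENNReal.ofReal ((1 - γ) * (1 - s ^ 2) * (1 / s) ^ (2 * j) * ε) <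
      S.fluctuation x₀ ξ (n - 1 - j) := by
  by_contra! hcon
  refine absurd hn (not_lt.2 ?_)
  refine (S.W1_particles_le hD hA hδ hμ x₀ ξ n).trans ?_
  rw [← hsk]
  have hs2 : 0 < 1 - s ^ 2 := by nlinarith
  have hγ' : 0 < 1 - γ := by linarith
  have hθ : 0 ≤ γ * ((1 - γ) / s ^ 4) ^ n * ε := by positivity
  have hj : ∀ j, 0 ≤ (1 - γ) * (1 - s ^ 2) * (1 / s) ^ (2 * j) * ε := fun j => by positivity
  calc _ ≤ ENNReal.ofReal (s ^ 4) ^ n * ENNReal.ofReal (γ * ((1 - γ) / s ^ 4) ^ n * ε) +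
        ∑ j ∈ Finset.range n, ENNReal.ofReal (s ^ 4) ^ j *
          ENNReal.ofReal ((1 - γ) * (1 - s ^ 2) * (1 / s) ^ (2 * j) * ε) := by
        gcongr with j hj'
        exact hcon j hj'
    _ = ENNReal.ofReal ((s ^ 4) ^ n * (γ * ((1 - γ) / s ^ 4) ^ n * ε) +
        ∑ j ∈ Finset.range n, (s ^ 4) ^ j *
          ((1 - γ) * (1 - s ^ 2) * (1 / s) ^ (2 * j) * ε)) := by
        rw [ENNReal.ofReal_add (by positivity) (Finset.sum_nonneg fun j _ =>
          mul_nonneg (by positivity) (hj j)), ENNReal.ofReal_sum_of_nonneg fun j _ =>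
          mul_nonneg (by positivity) (hj j)]
        simp only [ENNReal.ofReal_mul (pow_nonneg (pow_nonneg hs.le 4) _),
          ENNReal.ofReal_pow (pow_nonneg hs.le 4)]
    _ ≤ ENNReal.ofReal ε := by
        refine ENNReal.ofReal_le_ofReal ?_
        -- The factor `k^n` cancels the denominator of `ϑ^n`. In `e2`, half of the contraction
        -- `s^{4j}` compensates the growing threshold and the other half keeps the series summable.
        have e1 : (s ^ 4) ^ n * (γ * ((1 - γ) / s ^ 4) ^ n * ε) = γ * (1 - γ) ^ n * ε := by
          rw [div_pow]; field_simp
        have e2 : ∀ j, (s ^ 4) ^ j * ((1 - γ) * (1 - s ^ 2) * (1 / s) ^ (2 * j) * ε) =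
            (1 - γ) * ε * ((s ^ 2) ^ j * (1 - s ^ 2)) := fun j => by
          rw [one_div, inv_pow, pow_mul s 2 j]
          have : (s ^ 4) ^ j = (s ^ 2) ^ j * (s ^ 2) ^ j := by rw [← mul_pow]; congr 1; ring
          rw [this]
          field_simp
        simp only [e1, e2]
        rw [← Finset.mul_sum, ← Finset.sum_mul, geom_sum_mul_neg]
        have h1 : (1 - γ) ^ n ≤ 1 := pow_le_one₀ hγ'.le (by linarith)
        have h2 : 1 - (s ^ 2) ^ n ≤ 1 := by
          have : 0 < (s ^ 2) ^ n := by positivity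
          linarith
        calc γ * (1 - γ) ^ n * ε + (1 - γ) * ε * (1 - (s ^ 2) ^ n)
            ≤ γ * 1 * ε + (1 - γ) * ε * 1 := by gcongr
          _ = ε := by ring

/-- The one-step estimate at the `j`-th scale of a geometric sequence of scales. -/
theorem measure_fluctuation_scale_le [NeZero d] {ω : ℝ} (hA : ‖S.A‖ ≤ Real.exp (-ω))
    (hδ : 0 ≤ S.δ) {M : ℝ} (hM : 0 ≤ M)
    (hD : ∀ᵐ z ∂(S.θ : Measure (E m)), S.D z ≤ ENNReal.ofReal M)
    (hρ : Real.exp (-ω) + 2 * S.δ * M < 1) {α lam : ℝ} (hlam : 0 < lam)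
    (hlα : lam * S.δ ≤ α * (1 - (Real.exp (-ω) + 2 * S.δ * M))) {K : ℝ} (hK : 0 ≤ K)
    (hD₁ : ∫⁻ z, ENNReal.ofReal (Real.exp (α * S.D₁ z)) ∂(S.θ : Measure (E m)) ≤
      ENNReal.ofReal K)
    {μ₀ : ProbabilityMeasure (E d)} (hμ₀ : expMoment lam μ₀ ≤ ENNReal.ofReal K)
    {Ω : Type*} [MeasurableSpace Ω] {P : Measure Ω} [IsProbabilityMeasure P] {N : ℕ+}
    {X₀ : Ω → Fin N → E d} {ξ : Ω → ℕ → Fin N → E m} (hin : IsInput P μ₀ S.θ X₀ ξ)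
    {b c g u ε H L : ℝ} (hb : 0 < b) (hb₁ : 16 * d * b ≤ 1) (hb₂ : 64 * b ^ 2 * 2 ^ d ≤ 1)
    (hb16 : b ≤ 1 / 16) (hc : 0 < c) (hc1 : c ≤ 1) (hg : 1 ≤ g) (hu : 1 ≤ u)
    (huN : u ^ (d + 2) = (N : ℕ)) (hε : 0 < ε) (hH : 0 < H) (hHu : H ≤ ε * u)
    (hH3 : H ^ 3 ≤ (N : ℕ) * ε ^ 2) (hLH : L ≤ H) (hLε : L * Real.log (1 / ε) ≤ H)
    (hL : 1 + (2 + K) * 16 / (lam * c) ≤ lam * b * c / 4 * L / 2) (j i : ℕ) :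
    P.real {w | ENNReal.ofReal (c * g ^ (2 * j) * ε) < S.fluctuation (X₀ w) (ξ w) i} ≤
      (2 * K + 1) * Real.exp (-(min (lam / 2) 1 * b * c * H * g ^ j)) := by
  have hpos : 0 ≤ (2 + K) * 16 / (lam * c) := by positivity
  have hgj : ∀ j : ℕ, 1 ≤ g ^ j := fun j => one_le_pow₀ hg
  have hg0 : 0 < g := by linarith
  -- The radius grows like `g^j` while the threshold grows like `g^{2j}`. If both grew at the same
  -- rate, `64 R³ ≤ N e²` would fail for large `j`; here it compares `g^{3j}` with `g^{4j}`.
  obtain ⟨R, hR⟩ : ∃ R, R = b * c * g ^ j * H := ⟨_, rfl⟩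
  obtain ⟨e, he⟩ : ∃ e, e = c * g ^ (2 * j) * ε := ⟨_, rfl⟩
  have e1 : g ^ (2 * j) = g ^ j * g ^ j := by rw [two_mul, pow_add]
  obtain ⟨y, hy⟩ : ∃ y, y = g ^ j := ⟨_, rfl⟩
  have hy1 : 1 ≤ y := hy ▸ hgj j
  rw [← he, ← hy]
  rw [e1, ← hy] at he
  rw [← hy] at hR
  have hy0 : 0 < y := by linarith
  have hRj : 0 < R := by rw [hR]; positivity
  have he0 : 0 < e := by rw [he]; positivity
  have hRH : b * c * H ≤ R := by
    rw [hR]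
    have := mul_le_mul_of_nonneg_left hy1 (by positivity : 0 ≤ b * c * H)
    linarith
  have hτ : 0 < lam * b * c / 4 := by positivity
  have hτR : lam * b * c / 4 * H ≤ lam * R / 4 := by
    have := mul_le_mul_of_nonneg_left hRH hlam.le
    linarith
  have h1 : R ≤ b * e * u := by
    calc R = b * c * (y * 1) * H := by rw [hR]; ring
      _ ≤ b * c * (y * y) * (ε * u) := by gcongr
      _ = b * e * u := by rw [he]; ring
  have h2 : 64 * R ^ 3 ≤ (N : ℕ) * e ^ 2 := by
    have hbb : 64 * b ^ 3 ≤ 1 := by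
      calc 64 * b ^ 3 ≤ 64 * (1 / 16) ^ 3 := by gcongr
        _ ≤ 1 := by norm_num
    calc 64 * R ^ 3 = (64 * b ^ 3) * (c * (c ^ 2 * (y ^ 3 * 1) * H ^ 3)) := by rw [hR]; ring
      _ ≤ 1 * (1 * (c ^ 2 * (y ^ 3 * y) * ((N : ℕ) * ε ^ 2))) := by gcongr
      _ = (N : ℕ) * e ^ 2 := by rw [he]; ring
  have h3 : 1 ≤ lam * R := by
    have hτH := mul_le_mul_of_nonneg_left hLH hτ.le
    linarith
  have h4 : (2 + K) * (R * Real.exp (-(lam * R / 2))) ≤ e / 4 := by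
    refine (mul_exp_neg_le hK hlam hτ hτR hc hε hLH hLε (by linarith) (by linarith)).trans ?_
    have hyy : 1 ≤ y * y := by nlinarith
    have := mul_le_mul_of_nonneg_left hyy (by positivity : 0 ≤ c * ε)
    rw [he]
    linarith
  refine (S.measure_fluctuation_gt_le hA hδ hM hD hρ hlam hlα hK hD₁ hμ₀ hin i hb₁ hb₂
    hu huN he0 hRj h1 h2 h3 h4).trans ?_
  have hTR : min (lam / 2) 1 * b * c * H * y = min (lam / 2) 1 * R := by rw [hR]; ring
  rw [hTR]
  have h5 : Real.exp (-(lam * R / 2)) ≤ Real.exp (-(min (lam / 2) 1 * R)) := by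
    refine Real.exp_le_exp.2 (neg_le_neg ?_)
    calc min (lam / 2) 1 * R ≤ lam / 2 * R := by gcongr; exact min_le_left _ _
      _ = _ := by ring
  have h6 : Real.exp (-R) ≤ Real.exp (-(min (lam / 2) 1 * R)) := by
    refine Real.exp_le_exp.2 (neg_le_neg ?_)
    calc min (lam / 2) 1 * R ≤ 1 * R := by gcongr; exact min_le_right _ _
      _ = _ := one_mul _
  have h7 := mul_le_mul_of_nonneg_left h5 (by positivity : 0 ≤ 2 * K)
  linarith

universe v

/-- Concentration uniformly in time, at a scale `H` that is compatible with `ε` and `N = u^{d+2}`. -/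
theorem exists_concentration [NeZero d] (μ₀ : ProbabilityMeasure (E d)) {ω : ℝ}
    (hA : ‖S.A‖ ≤ Real.exp (-ω)) (hδ : 0 ≤ S.δ) {M : ℝ} (hM : 0 ≤ M)
    (hD : ∀ᵐ z ∂(S.θ : Measure (E m)), S.D z ≤ ENNReal.ofReal M)
    (hρ : Real.exp (-ω) + 2 * S.δ * M < 1) {α : ℝ} (hα : 0 < α)
    (hμ₀ : Integrable (fun x => Real.exp (α * ‖x‖)) (μ₀ : Measure (E d)))
    (hD₁ : Integrable (fun z => Real.exp (α * S.D₁ z)) (S.θ : Measure (E m)))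
    {γ : ℝ} (hγ : 0 ≤ γ) (hγ1 : γ < 1) (hk : Real.exp (-ω) + 2 * S.δ * S.σ < 1) :
    ∃ L : ℝ, 0 < L ∧ ∃ C₁ : ℝ, 0 < C₁ ∧
      ∀ (N : ℕ+) (Ω : Type v) [MeasurableSpace Ω] (P : Measure Ω) [IsProbabilityMeasure P]
        (X₀ : Ω → Fin N → E d) (ξ : Ω → ℕ → Fin N → E m), IsInput P μ₀ S.θ X₀ ξ →
      ∀ (ε u H : ℝ) (n : ℕ), 0 < ε → 1 ≤ u → u ^ (d + 2) = (N : ℕ) → H ≤ ε * u →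
        H ^ 3 ≤ (N : ℕ) * ε ^ 2 → L ≤ H → L * Real.log (1 / ε) ≤ H →
      P.real {w | ENNReal.ofReal ε <
          W1 (empirical (S.particles (X₀ w) (ξ w) n)) (S.law μ₀ n)} ≤
        P.real {w | ENNReal.ofReal
          (γ * ((1 - γ) / (Real.exp (-ω) + 2 * S.δ * S.σ)) ^ n * ε) <
          W1 (empirical (X₀ w)) μ₀} + Real.exp (-(C₁ * H)) := by
  have hd : (0 : ℝ) < d := by exact_mod_cast Nat.pos_of_neZero d
  have hd1 : (1 : ℝ) ≤ d := by exact_mod_cast Nat.pos_of_neZero d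
  set ρ := Real.exp (-ω) + 2 * S.δ * M with hρdef
  set k := Real.exp (-ω) + 2 * S.δ * S.σ with hkdef
  have hk0 : 0 < k := by
    have := S.sigma_nonneg
    positivity
  have hρ' : 0 < 1 - ρ := by linarith
  -- Chosen so that both `lam * δ ≤ α(1 - ρ)` and `lam ≤ α`; adding `1` in the denominator covers `δ
  -- = 0`.
  set lam := α * (1 - ρ) / (S.δ + 1) with hlamdef
  have hlam : 0 < lam := by positivity
  have hlα : lam * S.δ ≤ α * (1 - ρ) := by
    rw [hlamdef, div_mul_eq_mul_div, div_le_iff₀ (by positivity)]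
    nlinarith [mul_pos hα hρ']
  have hlα' : lam ≤ α := by
    rw [hlamdef, div_le_iff₀ (by positivity)]
    have : 0 ≤ ρ := by positivity
    nlinarith
  set K := 1 + ∫ x, Real.exp (α * ‖x‖) ∂(μ₀ : Measure (E d)) +
    ∫ z, Real.exp (α * S.D₁ z) ∂(S.θ : Measure (E m)) with hKdef
  have hI1 : 0 ≤ ∫ x, Real.exp (α * ‖x‖) ∂(μ₀ : Measure (E d)) :=
    integral_nonneg fun _ => (Real.exp_pos _).le
  have hI2 : 0 ≤ ∫ z, Real.exp (α * S.D₁ z) ∂(S.θ : Measure (E m)) :=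
    integral_nonneg fun _ => (Real.exp_pos _).le
  have hK : 0 < K := by linarith
  have hKθ : ∫⁻ z, ENNReal.ofReal (Real.exp (α * S.D₁ z)) ∂(S.θ : Measure (E m)) ≤
      ENNReal.ofReal K := by
    rw [← ofReal_integral_eq_lintegral_ofReal hD₁
      (Filter.Eventually.of_forall fun _ => (Real.exp_pos _).le)]
    exact ENNReal.ofReal_le_ofReal (by linarith)
  have hKμ : expMoment lam μ₀ ≤ ENNReal.ofReal K := by
    calc expMoment lam μ₀ ≤ expMoment α μ₀ := by
          refine lintegral_mono fun x => ENNReal.ofReal_le_ofReal (Real.exp_le_exp.2 ?_)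
          gcongr
      _ ≤ ENNReal.ofReal K := by
          rw [expMoment, ← ofReal_integral_eq_lintegral_ofReal hμ₀
            (Filter.Eventually.of_forall fun _ => (Real.exp_pos _).le)]
          exact ENNReal.ofReal_le_ofReal (by linarith)
  have hlaw := S.finiteFirstMoment_law hA hδ hM hD hρ hlam hlα
    (ne_top_of_le_ne_top ENNReal.ofReal_ne_top hKθ)
    (ne_top_of_le_ne_top ENNReal.ofReal_ne_top hKμ)
  -- A fourth root of `k`, so that `g = 1/s` gives radii growing like `k^{-j/4}` and thresholds like
  -- `k^{-j/2}`.
  set s := √(√k) with hsdef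
  have hs : 0 < s := by positivity
  have hsk : s ^ 4 = k := by
    have : s ^ 4 = (s ^ 2) ^ 2 := by ring
    rw [this, hsdef, Real.sq_sqrt (by positivity), Real.sq_sqrt hk0.le]
  have hs1 : s < 1 := by
    by_contra h
    have : 1 ≤ s ^ 4 := one_le_pow₀ (not_lt.1 h)
    linarith
  have hs2 : 0 < 1 - s ^ 2 := by nlinarith
  set g := 1 / s with hgdef
  have hg : 1 < g := by rw [hgdef, lt_div_iff₀ hs]; linarith
  have hg0 : 0 < g := by linarith
  set c := (1 - γ) * (1 - s ^ 2) with hcdef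
  have hc : 0 < c := mul_pos (by linarith) hs2
  have hc1 : c ≤ 1 := by
    have : 0 < s ^ 2 := by positivity
    rw [hcdef]
    exact mul_le_one₀ (by linarith) hs2.le (by linarith)
  set b := 1 / (16 * (d : ℝ) * 2 ^ d) with hbdef
  have hb : 0 < b := by positivity
  have h2d : (1 : ℝ) ≤ 2 ^ d := one_le_pow₀ (by norm_num)
  have hb₁ : 16 * d * b ≤ 1 := by
    have : 16 * d * b = 1 / 2 ^ d := by rw [hbdef]; field_simp
    rw [this, div_le_one (by positivity)]
    exact h2d
  have hb16 : b ≤ 1 / 16 := by nlinarith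
  have hb₂ : 64 * b ^ 2 * 2 ^ d ≤ 1 := by
    have e : b * 2 ^ d = 1 / (16 * d) := by rw [hbdef]; field_simp
    have e' : 1 / (16 * (d : ℝ)) ≤ 1 / 16 := by
      apply one_div_le_one_div_of_le <;> linarith
    calc 64 * b ^ 2 * 2 ^ d = 64 * b * (b * 2 ^ d) := by ring
      _ ≤ 64 * (1 / 16) * (1 / 16) := by rw [e]; gcongr
      _ ≤ 1 := by norm_num
  set lam' := min (lam / 2) 1 with hlam'def
  have hlam' : 0 < lam' := lt_min (by positivity) one_pos
  set τ := lam * b * c / 4 with hτdef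
  have hτ : 0 < τ := by positivity
  -- `H ≥ L₁` makes the tail error small at every scale. `H ≥ L₂` gives `T ≥ 1/(g - 1)`, needed to
  -- sum over scales, and `T ≥ 4(2K + 1)`, needed to absorb the prefactor.
  set L₁ := 2 / τ * (1 + (2 + K) * 16 / (lam * c)) with hL₁def
  set L₂ := (1 / (g - 1) + 4 * (2 * K + 1)) / (lam' * b * c) with hL₂def
  have hg1 : 0 < g - 1 := by linarith
  have hL₁ : 0 < L₁ := by positivity
  have hL₂ : 0 < L₂ := by positivity
  refine ⟨L₁ + L₂, by positivity, lam' * b * c / 2, by positivity, ?_⟩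
  intro N Ω _ P _ X₀ ξ hin ε u H n hε hu huN hHu hH3 hLH hLε
  have hN : (0 : ℝ) < (N : ℕ) := by exact_mod_cast N.pos
  have hH : 0 < H := by linarith
  have hτL : τ * L₁ / 2 = 1 + (2 + K) * 16 / (lam * c) := by
    rw [hL₁def]; field_simp
  have hτL' : 1 + (2 + K) * 16 / (lam * c) ≤ τ * (L₁ + L₂) / 2 := by
    rw [← hτL]
    have : 0 ≤ τ * L₂ := by positivity
    linarith
  set T := lam' * b * c * H with hTdef
  have hT : 1 / (g - 1) + 4 * (2 * K + 1) ≤ T := by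
    have e : lam' * b * c * L₂ = 1 / (g - 1) + 4 * (2 * K + 1) := by
      rw [hL₂def]; field_simp
    rw [← e, hTdef]
    have : L₂ ≤ H := by linarith
    gcongr
  set e : ℕ → ℝ := fun j => c * g ^ (2 * j) * ε with hedef
  have hstep : ∀ j i, P.real {w | ENNReal.ofReal (e j) < S.fluctuation (X₀ w) (ξ w) i} ≤
      (2 * K + 1) * Real.exp (-(T * g ^ j)) := fun j i =>
    S.measure_fluctuation_scale_le hA hδ hM hD hρ hlam hlα hK.le hKθ hKμ hin hb hb₁ hb₂ hb16 hc
      hc1 hg.le hu huN hε hH hHu hH3 hLH hLε hτL' j i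
  set A₀ := {w | ENNReal.ofReal (γ * ((1 - γ) / k) ^ n * ε) < W1 (empirical (X₀ w)) μ₀} with hA₀
  have hsubset : {w | ENNReal.ofReal ε <
      W1 (empirical (S.particles (X₀ w) (ξ w) n)) (S.law μ₀ n)} ⊆
      A₀ ∪ ⋃ j ∈ Finset.range n,
        {w | ENNReal.ofReal (e j) < S.fluctuation (X₀ w) (ξ w) (n - 1 - j)} := by
    intro w hw
    by_cases hw0 : w ∈ A₀
    · exact Or.inl hw0
    · right
      have h0 : W1 (empirical (X₀ w)) μ₀ ≤ ENNReal.ofReal (γ * ((1 - γ) / s ^ 4) ^ n * ε) := by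
        rw [hsk]
        exact not_lt.1 hw0
      obtain ⟨j, hj, hlt⟩ := S.exists_fluctuation_gt hD hA hδ hlaw hγ hγ1 hs hs1 hsk hε h0 hw
      simp only [Set.mem_iUnion]
      exact ⟨j, hj, hlt⟩
  -- Only monotonicity and subadditivity of `P` are used, so measurability of the `W1` events plays
  -- no role.
  refine (measureReal_mono hsubset (measure_ne_top _ _)).trans ?_
  refine (measureReal_union_le _ _).trans (add_le_add le_rfl ?_)
  refine (measureReal_biUnion_finset_le _ _).trans ?_
  refine (Finset.sum_le_sum fun j _ => hstep j (n - 1 - j)).trans ?_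
  rw [← Finset.mul_sum]
  have hTg : 1 ≤ T * (g - 1) := by
    rw [← div_le_iff₀ hg1]
    linarith
  have hsum := sum_exp_neg_mul_pow_le hg hTg n
  calc (2 * K + 1) * ∑ j ∈ Finset.range n, Real.exp (-(T * g ^ j))
      ≤ (2 * K + 1) * (2 * Real.exp (-T)) := by gcongr
    _ = (2 * (2 * K + 1)) * Real.exp (-(T / 2)) * Real.exp (-(T / 2)) := by
        have : Real.exp (-T) = Real.exp (-(T / 2)) * Real.exp (-(T / 2)) := by
          rw [← Real.exp_add]; congr 1; ring
        rw [this]; ring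
    -- Half of the exponent is spent on the prefactor `2(2K + 1)`; hence the factor `1/2` in `C₁`.
    _ ≤ 1 * Real.exp (-(T / 2)) := by
        gcongr
        rw [Real.exp_neg, ← div_eq_mul_inv, div_le_one (Real.exp_pos _)]
        have hg2 : 0 < 1 / (g - 1) := by positivity
        linarith [Real.add_one_le_exp (T / 2)]
    _ = Real.exp (-(lam' * b * c / 2 * H)) := by
        rw [one_mul, hTdef]; congr 1; ring

/-! ### Parameter constraints and admissible scales -/

/-- This one inequality contains `γ < 1`, `k < 1` and `ϑ > 1`. The case `σ = 0`, where `a₀ = ∞`, is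
separate because no real quotient is then available. -/
theorem two_mul_sigma_mul_add_lt {ω γ₀ : ℝ} (hω : 0 < ω) (hγ₀ : 0 < γ₀) (hδ : 0 ≤ S.δ)
    (hδa : ENNReal.ofReal S.δ < S.a₀ ω - ENNReal.ofReal γ₀) :
    2 * S.σ * (S.δ + γ₀) < 1 - Real.exp (-ω) := by
  have hexp : Real.exp (-ω) < 1 := by simpa using hω
  rcases S.sigma_nonneg.eq_or_lt with h0 | hpos
  · rw [← h0]; linarith
  have h1 : ENNReal.ofReal (S.δ + γ₀) < S.a₀ ω := by
    rw [ENNReal.ofReal_add hδ hγ₀.le]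
    exact lt_tsub_iff_right.1 hδa
  rw [a₀, ← ENNReal.ofReal_div_of_pos (by positivity),
    ENNReal.ofReal_lt_ofReal_iff_of_nonneg (by positivity), lt_div_iff₀ (by positivity)] at h1
  linarith

end Model

theorem mul_le_of_pow_le {k : ℕ} (hk : k ≠ 0) {v a u n N₀ : ℝ} (hu : 0 ≤ u)
    (ha : 0 ≤ a) (hun : u ^ k = n) (hvN : v ^ k ≤ N₀) (h : N₀ * a ^ k ≤ n) : v * a ≤ u := by
  refine le_of_pow_le_pow_left₀ hk hu ?_
  rw [mul_pow, hun]
  exact (mul_le_mul_of_nonneg_right hvN (by positivity)).trans h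

theorem half_le_log_inv {ε : ℝ} (hε : 0 < ε) (h : ε < 1 / 2) : 1 / 2 ≤ Real.log (1 / ε) := by
  have h1 : (2 : ℝ) ≤ 1 / ε := by
    rw [le_div_iff₀ hε]; linarith
  have h2 := Real.log_le_log (by norm_num) h1
  linarith [Real.log_two_gt_d9]

/-- In dimension `d > 1`, the scale `ε N^{1/(d+2)}` is admissible for `N` large. -/
theorem scale_admissible_of_one_lt {d : ℕ} (hd : 1 < d) {L ε u n N₀ : ℝ} (hL : 0 < L) (hε : 0 < ε)
    (hu1 : 1 ≤ u) (huN : u ^ (d + 2) = n) (hN₀ : (4 * L + 1) ^ (d + 2) ≤ N₀)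
    (hN : N₀ * max ((1 / ε * Real.posLog (1 / ε)) ^ (d + 2))
      (ε ^ (((d : ℝ) + 2) / ((d : ℝ) - 1))) ≤ n) :
    (ε * u) ^ 3 ≤ n * ε ^ 2 ∧ L ≤ ε * u ∧ L * Real.log (1 / ε) ≤ ε * u := by
  have hN₀0 : 0 ≤ N₀ := le_trans (by positivity) hN₀
  have hlog : 0 ≤ 1 / ε * Real.posLog (1 / ε) := mul_nonneg (by positivity) Real.posLog_nonneg
  have hlog' : Real.log (1 / ε) ≤ Real.posLog (1 / ε) := le_max_right _ _
  have hd2 : (1 : ℝ) ≤ (d : ℝ) - 1 := by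
    have : (2 : ℝ) ≤ d := by exact_mod_cast hd
    linarith
  -- With `y^{d-1} = ε`, the second term of the maximum gives `y ≤ u`, hence `ε ≤ u^{d-1}`; this is
  -- precisely the cubic condition `(εu)³ ≤ u^{d+2} ε²`.
  set y := ε ^ (1 / ((d : ℝ) - 1)) with hy
  have hy0 : 0 < y := Real.rpow_pos_of_pos hε _
  have hypow : ε ^ (((d : ℝ) + 2) / ((d : ℝ) - 1)) = y ^ (d + 2) := by
    rw [hy, ← Real.rpow_mul_natCast hε.le]
    congr 1
    push_cast
    ring
  have hyd : y ^ (d - 1) = ε := by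
    rw [hy, ← Real.rpow_mul_natCast hε.le, Nat.cast_sub hd.le, Nat.cast_one,
      one_div_mul_cancel (by linarith), Real.rpow_one]
  rw [hypow] at hN
  have h1 : (4 * L + 1) * (1 / ε * Real.posLog (1 / ε)) ≤ u :=
    mul_le_of_pow_le (by omega) (by linarith) hlog huN hN₀
      ((mul_le_mul_of_nonneg_left (le_max_left _ _) hN₀0).trans hN)
  have h2 : (4 * L + 1) * y ≤ u :=
    mul_le_of_pow_le (by omega) (by linarith) hy0.le huN hN₀
      ((mul_le_mul_of_nonneg_left (le_max_right _ _) hN₀0).trans hN)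
  have h1' : (4 * L + 1) * Real.posLog (1 / ε) ≤ ε * u := by
    have := mul_le_mul_of_nonneg_left h1 hε.le
    have e : ε * ((4 * L + 1) * (1 / ε * Real.posLog (1 / ε))) =
        (4 * L + 1) * Real.posLog (1 / ε) := by field_simp
    rwa [e] at this
  have hpl : 0 ≤ Real.posLog (1 / ε) := Real.posLog_nonneg
  have hLH : L ≤ ε * u := by
    -- For small `ε` the logarithm is at least `1/2`. Otherwise `y ≥ 1/2`, so `εu ≥ (4L + 1)/4 ≥ L`:
    -- this is the origin of the constant `4L + 1`.
    by_cases hε2 : ε < 1 / 2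
    · have := (half_le_log_inv hε hε2).trans hlog'
      nlinarith
    · push Not at hε2
      have hy2 : 1 / 2 ≤ y := by
        by_cases hε1 : ε ≤ 1
        · have : ε ^ (1 : ℝ) ≤ y := Real.rpow_le_rpow_of_exponent_ge hε hε1
            (by rw [div_le_one (by linarith)]; exact hd2)
          rw [Real.rpow_one] at this
          linarith
        · have : 1 ≤ y := Real.one_le_rpow (by linarith) (by positivity)
          linarith
      have h3 : (4 * L + 1) * (1 / 2) ≤ u := le_trans (by gcongr) h2
      nlinarith
  have hyu : y ≤ u := by nlinarith
  have hεu : ε ≤ u ^ (d - 1) := by rw [← hyd]; gcongr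
  have hH3 : (ε * u) ^ 3 ≤ n * ε ^ 2 := by
    rw [← huN, show d + 2 = (d - 1) + 3 by omega, pow_add]
    calc (ε * u) ^ 3 = ε * (u ^ 3 * ε ^ 2) := by ring
      _ ≤ u ^ (d - 1) * (u ^ 3 * ε ^ 2) := by gcongr
      _ = _ := by ring
  exact ⟨hH3, hLH, by nlinarith [mul_le_mul_of_nonneg_left hlog' hL.le]⟩

/-- In dimension one, the scale `(ε ∧ 1) N^{1/3}` is admissible for `N` large. -/
theorem scale_admissible_one {d : ℕ} (hd : d = 1) {L ε u n N₀ : ℝ} (hL : 0 < L) (hε : 0 < ε)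
    (hu1 : 1 ≤ u) (huN : u ^ (d + 2) = n) (hN₀ : (4 * L + 1) ^ (d + 2) ≤ N₀)
    (hN : N₀ * max ((1 / ε * Real.posLog (1 / ε)) ^ (d + 2)) 1 ≤ n) :
    (min ε 1 * u) ^ 3 ≤ n * ε ^ 2 ∧ L ≤ min ε 1 * u ∧ L * Real.log (1 / ε) ≤ min ε 1 * u := by
  have hN₀0 : 0 ≤ N₀ := le_trans (by positivity) hN₀
  have hlog : 0 ≤ 1 / ε * Real.posLog (1 / ε) := mul_nonneg (by positivity) Real.posLog_nonneg
  have hlog' : Real.log (1 / ε) ≤ Real.posLog (1 / ε) := le_max_right _ _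
  have h1 : (4 * L + 1) * (1 / ε * Real.posLog (1 / ε)) ≤ u :=
    mul_le_of_pow_le (by omega) (by linarith) hlog huN hN₀
      ((mul_le_mul_of_nonneg_left (le_max_left _ _) hN₀0).trans hN)
  have h2 : (4 * L + 1) * 1 ≤ u :=
    mul_le_of_pow_le (by omega) (by linarith) zero_le_one huN hN₀
      (by
        rw [one_pow]
        exact (mul_le_mul_of_nonneg_left (le_max_right _ _) hN₀0).trans hN)
  have h1' : (4 * L + 1) * Real.posLog (1 / ε) ≤ ε * u := by
    have := mul_le_mul_of_nonneg_left h1 hε.le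
    have e : ε * ((4 * L + 1) * (1 / ε * Real.posLog (1 / ε))) =
        (4 * L + 1) * Real.posLog (1 / ε) := by field_simp
    rwa [e] at this
  have hpl : 0 ≤ Real.posLog (1 / ε) := Real.posLog_nonneg
  have hmin0 : 0 < min ε 1 := lt_min hε one_pos
  have hLH : L ≤ min ε 1 * u := by
    by_cases hε2 : ε < 1 / 2
    · rw [min_eq_left (by linarith)]
      have := (half_le_log_inv hε hε2).trans hlog'
      nlinarith
    · push Not at hε2
      have : 1 / 2 ≤ min ε 1 := le_min hε2 (by norm_num)
      nlinarith
  have hLε : L * Real.log (1 / ε) ≤ min ε 1 * u := by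
    rcases le_total ε 1 with hε1 | hε1
    · rw [min_eq_left hε1]
      nlinarith [mul_le_mul_of_nonneg_left hlog' hL.le]
    · have hneg : Real.log (1 / ε) ≤ 0 :=
        Real.log_nonpos (by positivity) (by rw [div_le_one hε]; exact hε1)
      have : 0 ≤ min ε 1 * u := by positivity
      nlinarith
  -- For `d = 1` the scale `εu` would require `ε ≤ 1`. Capping at `1` gives `min(ε, 1)³ ≤ ε²` for
  -- every `ε`.
  have hH3 : (min ε 1 * u) ^ 3 ≤ n * ε ^ 2 := by
    rw [← huN, show d + 2 = 3 by omega]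
    calc (min ε 1 * u) ^ 3 = min ε 1 * (u ^ 3 * min ε 1 ^ 2) := by ring
      _ ≤ 1 * (u ^ 3 * ε ^ 2) := by
        gcongr
        · exact min_le_right _ _
        · exact min_le_left _ _
      _ = _ := one_mul _
  exact ⟨hH3, hLH, hLε⟩

end WeaklyInteracting

end

/-! ### Assembly of the theorem -/

theorem theorem3p8 {d m : ℕ} (S : WeaklyInteracting.Model d m)
    (μ₀ : ProbabilityMeasure (WeaklyInteracting.E d))
    -- for every `N`, a probability space with the initial positions and the noises
    {Ω : ℕ+ → Type*} [∀ N, MeasurableSpace (Ω N)]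
    (P : ∀ N, Measure (Ω N)) [∀ N, IsProbabilityMeasure (P N)]
    (X₀ : ∀ N : ℕ+, Ω N → Fin N → WeaklyInteracting.E d)
    (ξ : ∀ N : ℕ+, Ω N → ℕ → Fin N → WeaklyInteracting.E m)
    (hinput : ∀ N : ℕ+, WeaklyInteracting.IsInput (P N) μ₀ S.θ (X₀ N) (ξ N))
    -- contractivity of the linear part
    (ω : ℝ) (hω : 0 < ω) (hA : ‖S.A‖ ≤ Real.exp (-ω))
    -- essential boundedness of the Lipschitz constant, and exponential moments
    (M : ℝ) (hM : 1 < M) (hD : ∀ᵐ z ∂(S.θ : Measure (WeaklyInteracting.E m)),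
      S.D z ≤ ENNReal.ofReal M)
    (α : ℝ) (hα : 0 < α)
    (hμ₀ : Integrable (fun x => Real.exp (α * ‖x‖)) (μ₀ : Measure (WeaklyInteracting.E d)))
    (hD₁ : Integrable (fun z => Real.exp (α * S.D₁ z)) (S.θ : Measure (WeaklyInteracting.E m)))
    -- `γ₀ ∈ (0, a₀)` and `δ ∈ [0, min {a₀ - γ₀, (1 - e^{-ω}) / (2M)})`
    (γ₀ : ℝ) (hγ₀ : 0 < γ₀) (hγ₀a : ENNReal.ofReal γ₀ < S.a₀ ω)
    (hδ : 0 ≤ S.δ) (hδa : ENNReal.ofReal S.δ < S.a₀ ω - ENNReal.ofReal γ₀)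
    (hδM : S.δ < (1 - Real.exp (-ω)) / (2 * M)) :
    1 < S.ϑ ω γ₀ ∧
    (1 < d → ∃ N₀ : ℕ, 0 < N₀ ∧ ∃ C₁ : ℝ, 0 < C₁ ∧ ∀ ε : ℝ, 0 < ε → ∀ n : ℕ, ∀ N : ℕ+,
      (N₀ : ℝ) * max ((1 / ε * Real.posLog (1 / ε)) ^ (d + 2))
          (ε ^ (((d : ℝ) + 2) / ((d : ℝ) - 1))) ≤ ((N : ℕ) : ℝ) →
      (P N).real {w | ENNReal.ofReal ε <
          WeaklyInteracting.W1 (WeaklyInteracting.empirical (S.particles (X₀ N w) (ξ N w) n))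
            (S.law μ₀ n)} ≤
        (P N).real {w | ENNReal.ofReal (2 * S.σ * γ₀ * S.ϑ ω γ₀ ^ n * ε) <
          WeaklyInteracting.W1 (WeaklyInteracting.empirical (X₀ N w)) μ₀} +
        Real.exp (-(C₁ * ε * ((N : ℕ) : ℝ) ^ (1 / ((d : ℝ) + 2))))) ∧
    (d = 1 → ∃ N₀ : ℕ, 0 < N₀ ∧ ∃ C₁ : ℝ, 0 < C₁ ∧ ∀ ε : ℝ, 0 < ε → ∀ n : ℕ, ∀ N : ℕ+,
      (N₀ : ℝ) * max ((1 / ε * Real.posLog (1 / ε)) ^ (d + 2)) 1 ≤ ((N : ℕ) : ℝ) →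
      (P N).real {w | ENNReal.ofReal ε <
          WeaklyInteracting.W1 (WeaklyInteracting.empirical (S.particles (X₀ N w) (ξ N w) n))
            (S.law μ₀ n)} ≤
        (P N).real {w | ENNReal.ofReal (2 * S.σ * γ₀ * S.ϑ ω γ₀ ^ n * ε) <
          WeaklyInteracting.W1 (WeaklyInteracting.empirical (X₀ N w)) μ₀} +
        Real.exp (-(C₁ * min ε 1 * ((N : ℕ) : ℝ) ^ (1 / ((d : ℝ) + 2))))) := by
  have hσ := S.sigma_nonneg
  have hexp := Real.exp_pos (-ω)
  have hkey := S.two_mul_sigma_mul_add_lt hω hγ₀ hδ hδa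
  have hγ : 0 ≤ 2 * S.σ * γ₀ := by positivity
  have hσδ : 0 ≤ 2 * S.δ * S.σ := by positivity
  have hγ1 : 2 * S.σ * γ₀ < 1 := by nlinarith
  have hk : Real.exp (-ω) + 2 * S.δ * S.σ < 1 := by nlinarith
  have hρ : Real.exp (-ω) + 2 * S.δ * M < 1 := by
    rw [lt_div_iff₀ (by linarith)] at hδM
    linarith
  have hroot : ∀ N : ℕ+, 1 ≤ ((N : ℕ) : ℝ) ^ (1 / ((d : ℝ) + 2)) ∧
      (((N : ℕ) : ℝ) ^ (1 / ((d : ℝ) + 2))) ^ (d + 2) = ((N : ℕ) : ℝ) := by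
    intro N
    refine ⟨Real.one_le_rpow (by exact_mod_cast N.pos) (by positivity), ?_⟩
    have := Real.rpow_inv_natCast_pow (x := ((N : ℕ) : ℝ)) (by positivity)
      (show d + 2 ≠ 0 by omega)
    rw [one_div]
    push_cast at this
    exact this
  -- `N₀` is the integer ceiling of `(4L + 1)^{d+2}`, so that the lower bound on `N` becomes one on
  -- its root `u`.
  have hsize : ∀ L : ℝ, 0 < L → (4 * L + 1) ^ (d + 2) ≤ (⌈(4 * L + 1) ^ (d + 2)⌉₊ : ℝ) ∧
      0 < ⌈(4 * L + 1) ^ (d + 2)⌉₊ := fun L hL => ⟨Nat.le_ceil _, Nat.ceil_pos.2 (by positivity)⟩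
  refine ⟨?_, fun hd => ?_, fun hd => ?_⟩
  · rw [WeaklyInteracting.Model.ϑ, lt_div_iff₀ (by positivity)]
    linarith
  · have : NeZero d := ⟨by omega⟩
    obtain ⟨L, hL, C₁, hC₁, hmain⟩ := S.exists_concentration μ₀ hA hδ (by linarith) hD hρ hα hμ₀
      hD₁ hγ hγ1 hk
    obtain ⟨hN₀, hN₀pos⟩ := hsize L hL
    refine ⟨_, hN₀pos, C₁, hC₁, fun ε hε n N hN => ?_⟩
    obtain ⟨hu1, huN⟩ := hroot N
    set u := ((N : ℕ) : ℝ) ^ (1 / ((d : ℝ) + 2)) with hu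
    obtain ⟨hH3, hLH, hLε⟩ :=
      WeaklyInteracting.scale_admissible_of_one_lt hd hL hε hu1 huN hN₀ hN
    have := hmain N (Ω N) (P N) (X₀ N) (ξ N) (hinput N) ε u (ε * u) n hε hu1 huN le_rfl hH3 hLH
      hLε
    rw [← mul_assoc] at this
    exact this
  · have : NeZero d := ⟨by omega⟩
    obtain ⟨L, hL, C₁, hC₁, hmain⟩ := S.exists_concentration μ₀ hA hδ (by linarith) hD hρ hα hμ₀
      hD₁ hγ hγ1 hk
    obtain ⟨hN₀, hN₀pos⟩ := hsize L hL
    refine ⟨_, hN₀pos, C₁, hC₁, fun ε hε n N hN => ?_⟩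
    obtain ⟨hu1, huN⟩ := hroot N
    set u := ((N : ℕ) : ℝ) ^ (1 / ((d : ℝ) + 2)) with hu
    obtain ⟨hH3, hLH, hLε⟩ :=
      WeaklyInteracting.scale_admissible_one hd hL hε hu1 huN hN₀ hN
    have := hmain N (Ω N) (P N) (X₀ N) (ξ N) (hinput N) ε u (min ε 1 * u) n hε hu1 huN
      (by gcongr; exact min_le_left _ _) hH3 hLH hLε
    rw [← mul_assoc] at this
    exact this
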